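/- Let $D\subset\mathbb{R}^d$ be a bounded open set (for instance a bounded domain) whose boundary has Lebesgue measure zero, and let $\lambda:\overline{D}\to(0,\infty)$ be continuous. Let $\mathcal{S}(\overline D)$ be the space of lower semicontinuous functions $\overline D\to\mathbb{R}\cup\{+\infty\}$, with the Borel $\sigma$-algebra of the topology of $\Gamma$-convergence, generated by the sets $\{f:\inf_U f<t\}$ ($U$ open) and $\{f:\inf_K f>t\}$ ($K$ compact). Let $W_\lambda$ be a random element of $\mathcal{S}(\overline D)$ such that 1. for every closed $C\subset\overline D$, $\min_{C}W_\lambda$ is exponentially distributed with rate $\int_C\lambda(x)\,dx$ (rate $0$ meaning $+\infty$ almost surely; $\min_\emptyset:=+\infty$); 2. for all pairwise disjoint closed $C_1,\dots,C_k\subset\overline D$, the variables $\min_{C_1}W_\lambda,\dots,\min_{C_k}W_\lambda$ are independent. Let $g\in\mathcal{S}(\overline D)$ be finite on a set of positive Lebesgue measure. Put $\bar\lambda:=\int_D\lambda(x)\,dx$ and $$H(s):=\frac1{\bar\lambda}\int_{\{x\in D:\,g(x)\le s\}}\lambda(x)\,dx .$$ Then almost surely $W_\lambda+g$ has a finite minimum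 $\tau^{(1)}$, attained at exactly one point $X^{(1)}\in\overline D$. The pair $(X^{(1)},\tau^{(1)})$ has, with respect to Lebesgue measure $dx\,d\tau$ on $\overline D\times\mathbb{R}$, the joint density $\lambda(x)\,\Psi(x,\tau,g)$, where $$\Psi(x,\tau,g)=\chi_{\tau>g(x)}\exp\Big(-\bar\lambda\int_{-\infty}^{\tau}H(s)\,ds\Big),$$ and consequently $X^{(1)}$ has, with respect to Lebesgue measure $dx$ on $\overline D$, the density $\lambda(x)\,\Phi(x,g)$, where $$\Phi(x,g)=\int_{g(x)}^{\infty}\exp\Big(-\bar\lambda\int_{-\infty}^{t}H(s)\,ds\Big)\,dt .$$ Equivalently, $\Psi$ and $\Phi$ are the densities with respect to $\lambda(x)\,dx\,d\tau$ and $\lambda(x)\,dx$. In particular, for $\lambda\equiv1$ they are the Lebesgue densities. -/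

import Mathlib

open MeasureTheory ProbabilityTheory Set

noncomputable section

namespace ExtremeValue

/-- The space `S(X)` of lower semicontinuous functions on `X` with values in `ℝ ∪ {+∞}`. -/
def LSCFun (X : Type*) [TopologicalSpace X] : Type _ :=
  {f : X → EReal // LowerSemicontinuous f ∧ ∀ x, f x ≠ ⊥}

instance (X : Type*) [TopologicalSpace X] : CoeFun (LSCFun X) (fun _ => X → EReal) :=
  ⟨fun f => f.1⟩

/-- The topology of Gamma-convergence: it is generated by the sets `{f : inf_U f < t}`, `U` open,
and `{f : inf_K f > t}`, `K` compact, with `t` real. -/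
instance (X : Type*) [TopologicalSpace X] : TopologicalSpace (LSCFun X) :=
  TopologicalSpace.generateFrom
    ({A | ∃ (U : Set X) (t : ℝ), IsOpen U ∧ A = {f : LSCFun X | (⨅ x ∈ U, f x) < (t : EReal)}} ∪
     {A | ∃ (K : Set X) (t : ℝ), IsCompact K ∧ A = {f : LSCFun X | (t : EReal) < ⨅ x ∈ K, f x}})

instance (X : Type*) [TopologicalSpace X] : MeasurableSpace (LSCFun X) := borel _

/-- The exponential law of rate `r ≥ 0` on the extended reals. The exponential law of rate `0`
is the point mass at `+∞`. -/
def expLaw (r : ℝ) : Measure EReal :=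
  if r = 0 then Measure.dirac ⊤ else (expMeasure r).map (fun t : ℝ => (t : EReal))

/-- The minimum value `m₁(f)`; the infimum is attained when `f` is lower semicontinuous on a
nonempty compact space. -/
def minValue {X : Type*} (f : X → EReal) : EReal := ⨅ x, f x

/-- The set `M₁(f)` of global minimizers. -/
def argminSet {X : Type*} (f : X → EReal) : Set X := {x | f x = minValue f}

variable {d : ℕ}

/-- Lebesgue measure on the space `closure D`. -/
def leb (D : Set (EuclideanSpace ℝ (Fin d))) : Measure (closure D) :=
  Measure.comap Subtype.val volume

/-- `W` is a version of the random lower semicontinuous function `W_λ` on `closure D`.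
The closed sets `C` range over the closed subsets of the space `closure D`. The minimum over the empty set is `+∞`. -/
structure IsExtremeValueProcess (D : Set (EuclideanSpace ℝ (Fin d))) (lam : closure D → ℝ)
    {Ω : Type*} [MeasurableSpace Ω] (P : Measure Ω) (W : Ω → LSCFun (closure D)) : Prop where
  measurable : Measurable W
  exponential : ∀ C : Set (closure D), IsClosed C →
    P.map (fun ω => ⨅ x ∈ C, W ω x) = expLaw (∫ x in C, lam x ∂(leb D))
  indep : ∀ (k : ℕ) (C : Fin k → Set (closure D)), (∀ i, IsClosed (C i)) →
    Pairwise (fun i j => Disjoint (C i) (C j)) →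
    iIndepFun (fun i ω => ⨅ x ∈ C i, W ω x) P

/-- The total rate `∫_D λ(x) dx`. -/
def lamBar (D : Set (EuclideanSpace ℝ (Fin d))) (lam : closure D → ℝ) : ℝ :=
  ∫ x in {x : closure D | (x : EuclideanSpace ℝ (Fin d)) ∈ D}, lam x ∂(leb D)

/-- The measure on `closure D` with density `λ(x) / ∫_D λ`. -/
def muLam (D : Set (EuclideanSpace ℝ (Fin d))) (lam : closure D → ℝ) : Measure (closure D) :=
  (leb D).withDensity (fun x => ENNReal.ofReal (lam x / lamBar D lam))

/-- `H(s)`, the normalized `λ`-measure of `{x ∈ D : h(x) ≤ s}`. -/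
def H (D : Set (EuclideanSpace ℝ (Fin d))) (lam : closure D → ℝ) (h : closure D → EReal)
    (s : ℝ) : ℝ :=
  (muLam D lam).real {x : closure D | (x : EuclideanSpace ℝ (Fin d)) ∈ D ∧ h x ≤ (s : EReal)}

/-- `exp (- λ̄ ∫_{-∞}^t H(s) ds)`. -/
def survival (D : Set (EuclideanSpace ℝ (Fin d))) (lam : closure D → ℝ) (h : closure D → EReal)
    (t : ℝ) : ℝ :=
  Real.exp (-(lamBar D lam) * ∫ s in Iic t, H D lam h s)

open Classical in
/-- `Ψ(z, t, h)`. -/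
def Psi (D : Set (EuclideanSpace ℝ (Fin d))) (lam : closure D → ℝ)
    (z : closure D) (t : ℝ) (h : closure D → EReal) : ℝ :=
  if h z < (t : EReal) then survival D lam h t else 0

/-- `Φ(z, h)`; the domain of integration is `(h(z), ∞)`, which is empty when `h(z) = +∞`. -/
def Phi (D : Set (EuclideanSpace ℝ (Fin d))) (lam : closure D → ℝ)
    (z : closure D) (h : closure D → EReal) : ℝ :=
  ∫ t in {t : ℝ | h z < (t : EReal)}, survival D lam h t

end ExtremeValue

end

namespace ExtremeValue

/-! Let `V = max W 0`, which is nonnegative everywhere and almost surely equal to `W`, and let `Λ`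
have density `λ`. The exponential and independence axioms give `P(V ≥ φ) = exp(-∫ φ dΛ)` for step
functions on disjoint closed sets. Monotone limits extend this to bounded `φ ≥ 0` whose sub- and
superlevel sets are Gδ (`IsExpInfProcess.prob_le`).

For closed `C`, let `A` and `B` be the infima of `V + g` over `C` and `Cᶜ`. The event `A ≥ s, B ≥ t`
says that `V ≥ φ`, where `φ` is `(s - g)⁺` on `C` and `(t - g)⁺` on `Cᶜ`. Hence `A` and `B` are
independent. By the layer-cake formula, `P(A ≥ s) = exp(-∫_{-∞}^s m_C)` with `m_C(u) = Λ(C ∩ {g ≤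
u})`, and similarly for `B` (`joint_survival`, `integral_excess`).

These laws have no atoms in `ℝ`, so finite ties between a set and its complement are null. Testing a
countable base of open sets gives uniqueness of the minimizer. Up to a null set, `X ∈ C, τ ≥ t` is
the event `t ≤ A < B`, of probability `∫_t^∞ m_C(r) exp(-∫_{-∞}^r m_K) dr` with `K` the whole space
(`prob_infAdd_lt_compl`). This determines the joint law on the π-system of closed sets times
half-lines, and integrating out time gives the law of `X`. -/

theorem exists_monotone_closed_iUnion_of_isGδ_compl {K : Type*} [TopologicalSpace K]
    {F : Set K} (hF : IsGδ Fᶜ) :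
    ∃ C : ℕ → Set K, (∀ n, IsClosed (C n)) ∧ Monotone C ∧ ⋃ n, C n = F := by
  obtain ⟨U, hU, hFU⟩ := isGδ_iff_eq_iInter_nat.1 hF
  refine ⟨Set.accumulate fun n => (U n)ᶜ, fun n => ?_, Set.monotone_accumulate, ?_⟩
  · rw [Set.accumulate_def]
    exact (Set.finite_Iic n).isClosed_biUnion fun i _ => (hU i).isClosed_compl
  · rw [Set.iUnion_accumulate, ← compl_iInter, ← hFU, compl_compl]

/-! ### Probability that the random function dominates a given function. -/

section Avoidance

variable {K Ω : Type*} [MetricSpace K] [MeasurableSpace K] [MeasurableSpace Ω]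

/-- The infima of the nonnegative random function `V` over disjoint closed sets are independent
and exponential, with rates given by `Λ`. -/
structure IsExpInfProcess (Λ : Measure K) (P : Measure Ω) (V : Ω → K → EReal) : Prop where
  nonneg : ∀ ω x, 0 ≤ V ω x
  measurableSet : ∀ C : Set K, IsClosed C → ∀ t : ℝ,
    MeasurableSet {ω | ∀ x ∈ C, (t : EReal) ≤ V ω x}
  prob : ∀ (k : ℕ) (C : Fin k → Set K), (∀ i, IsClosed (C i)) →
    Pairwise (fun i j => Disjoint (C i) (C j)) → ∀ t : Fin k → ℝ, (∀ i, 0 ≤ t i) →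
    P.real {ω | ∀ i, ∀ x ∈ C i, (t i : EReal) ≤ V ω x} = Real.exp (-∑ i, t i * Λ.real (C i))

variable {Λ : Measure K} [IsFiniteMeasure Λ] {P : Measure Ω} [IsFiniteMeasure P]
  {V : Ω → K → EReal}

theorem tendsto_measureReal_iInter_of_antitone {s : ℕ → Set Ω} (hs : ∀ n, MeasurableSet (s n))
    (ha : Antitone s) :
    Filter.Tendsto (fun n => P.real (s n)) Filter.atTop (nhds (P.real (⋂ n, s n))) :=
  (ENNReal.tendsto_toReal (measure_ne_top _ _)).comp
    (tendsto_measure_iInter_atTop (fun n => (hs n).nullMeasurableSet) ha ⟨0, measure_ne_top _ _⟩)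

/-- Exhaust each Fσ set by increasing closed sets: the events decrease, the rates increase, and both
sides converge. Dyadic level sets of a semicontinuous function need not be closed, so this extension
is needed. -/
theorem IsExpInfProcess.fSigma (h : IsExpInfProcess Λ P V) (k : ℕ) (F : Fin k → Set K)
    (hF : ∀ i, IsGδ (F i)ᶜ) (hd : Pairwise (fun i j => Disjoint (F i) (F j)))
    (t : Fin k → ℝ) (ht : ∀ i, 0 ≤ t i) :
    MeasurableSet {ω | ∀ i, ∀ x ∈ F i, (t i : EReal) ≤ V ω x} ∧
    P.real {ω | ∀ i, ∀ x ∈ F i, (t i : EReal) ≤ V ω x} =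
      Real.exp (-∑ i, t i * Λ.real (F i)) := by
  choose C hC hmono hun using fun i => exists_monotone_closed_iUnion_of_isGδ_compl (hF i)
  have hE : {ω | ∀ i, ∀ x ∈ F i, (t i : EReal) ≤ V ω x} =
      ⋂ n, {ω | ∀ i, ∀ x ∈ C i n, (t i : EReal) ≤ V ω x} := by
    ext ω
    simp only [mem_ofPred_eq, mem_iInter, ← hun, mem_iUnion]
    exact ⟨fun H n i x hx => H i x ⟨n, hx⟩, fun H i x ⟨n, hx⟩ => H n i x hx⟩
  have hm : ∀ n, MeasurableSet {ω | ∀ i, ∀ x ∈ C i n, (t i : EReal) ≤ V ω x} := fun n => by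
    rw [ofPred_forall]
    exact MeasurableSet.iInter fun i => h.measurableSet _ (hC i n) _
  rw [hE]
  refine ⟨MeasurableSet.iInter hm, ?_⟩
  have h1 := tendsto_measureReal_iInter_of_antitone (P := P) hm
    (fun m n hmn ω hω i x hx => hω i x (hmono i hmn hx))
  refine tendsto_nhds_unique h1 ?_
  have h2 : ∀ n, P.real {ω | ∀ i, ∀ x ∈ C i n, (t i : EReal) ≤ V ω x} =
      Real.exp (-∑ i, t i * Λ.real (C i n)) := fun n =>
    h.prob k (fun i => C i n) (fun i => hC i n)
      (fun i j hij => (hd hij).mono (hun i ▸ subset_iUnion _ n) (hun j ▸ subset_iUnion _ n)) t ht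
  simp_rw [h2]
  refine (Real.continuous_exp.tendsto _).comp (Filter.Tendsto.neg ?_)
  refine tendsto_finsetSum _ fun i _ => Filter.Tendsto.const_mul _ ?_
  rw [← hun i]
  exact (ENNReal.tendsto_toReal (measure_ne_top _ _)).comp
    (tendsto_measure_iUnion_atTop (hmono i))

/-- The dyadic approximation of `a` from below, at level `n`. -/
noncomputable def dyadicFloor (n : ℕ) (a : ℝ) : ℝ := (⌊2 ^ n * a⌋₊ : ℝ) / 2 ^ n

theorem dyadicFloor_le {a : ℝ} (ha : 0 ≤ a) (n : ℕ) : dyadicFloor n a ≤ a := by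
  rw [dyadicFloor, div_le_iff₀ (by positivity), mul_comm a]
  exact Nat.floor_le (by positivity)

theorem dyadicFloor_nonneg (n : ℕ) (a : ℝ) : 0 ≤ dyadicFloor n a := by
  unfold dyadicFloor; positivity

theorem sub_lt_dyadicFloor (n : ℕ) (a : ℝ) : a - (1 / 2) ^ n < dyadicFloor n a := by
  have := Nat.lt_floor_add_one (2 ^ n * a)
  rw [dyadicFloor, lt_div_iff₀ (by positivity), sub_mul, ← mul_pow]
  norm_num
  linarith

theorem dyadicFloor_mono {a : ℝ} (ha : 0 ≤ a) : Monotone fun n => dyadicFloor n a := by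
  refine monotone_nat_of_le_succ fun n => ?_
  have h1 := Nat.floor_le (show 0 ≤ 2 ^ n * a by positivity)
  have h2 : 2 * ⌊2 ^ n * a⌋₊ ≤ ⌊2 ^ (n + 1) * a⌋₊ := by
    refine Nat.le_floor ?_
    push_cast
    rw [pow_succ]
    linarith
  have h3 : (2 * ⌊2 ^ n * a⌋₊ : ℝ) ≤ ⌊2 ^ (n + 1) * a⌋₊ := by exact_mod_cast h2
  unfold dyadicFloor
  rw [div_le_div_iff₀ (by positivity) (by positivity), pow_succ]
  rw [pow_succ] at h3
  nlinarith [pow_pos (two_pos : (0 : ℝ) < 2) n]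

theorem tendsto_dyadicFloor {a : ℝ} (ha : 0 ≤ a) :
    Filter.Tendsto (fun n => dyadicFloor n a) Filter.atTop (nhds a) := by
  refine tendsto_of_tendsto_of_tendsto_of_le_of_le (g := fun n : ℕ => a - (1 / 2) ^ n) ?_
    tendsto_const_nhds (fun n => (sub_lt_dyadicFloor n a).le) fun n => dyadicFloor_le ha n
  simpa using (tendsto_const_nhds (x := a)).sub
    (tendsto_pow_atTop_nhds_zero_of_lt_one (r := (1 / 2 : ℝ)) (by norm_num) (by norm_num))

/-- The probability that `V` dominates the bounded function `φ`. -/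
theorem IsExpInfProcess.prob_le [BorelSpace K] (h : IsExpInfProcess Λ P V) {φ : K → ℝ} (h0 : ∀ x, 0 ≤ φ x)
    {M : ℝ} (hM : ∀ x, φ x ≤ M) (hlt : ∀ a, IsGδ {x | φ x < a}) (hle : ∀ a, IsGδ {x | a ≤ φ x}) :
    MeasurableSet {ω | ∀ x, (φ x : EReal) ≤ V ω x} ∧
    P.real {ω | ∀ x, (φ x : EReal) ≤ V ω x} = Real.exp (-∫ x, φ x ∂Λ) := by
  have hφm : Measurable φ := measurable_of_Iio fun a => (hlt a).measurableSet
  -- The extra index is there because the floor may attain `⌊2 ^ n * M⌋₊`.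
  let N : ℕ → ℕ := fun n => ⌊2 ^ n * M⌋₊ + 1
  let F : (n : ℕ) → Fin (N n) → Set K := fun n i => {x | ⌊2 ^ n * φ x⌋₊ = i}
  let t : (n : ℕ) → Fin (N n) → ℝ := fun n i => (i : ℕ) / 2 ^ n
  have ht : ∀ n i, 0 ≤ t n i := fun n i => by simp only [t]; positivity
  have hN : ∀ n x, ⌊2 ^ n * φ x⌋₊ < N n := fun n x =>
    Nat.lt_succ_of_le (Nat.floor_le_floor (by gcongr; exact hM x))
  -- Off a dyadic level set, `φ` lies either below the cell or at or above its right end; both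
  -- conditions are Gδ.
  have hFG : ∀ n i, IsGδ (F n i)ᶜ := fun n i => by
    have : (F n i)ᶜ = {x | φ x < (i : ℕ) / 2 ^ n} ∪ {x | (((i : ℕ) : ℝ) + 1) / 2 ^ n ≤ φ x} := by
      ext x
      have h2 : (0 : ℝ) < 2 ^ n := by positivity
      simp only [F, mem_compl_iff, mem_ofPred_eq, mem_union, lt_div_iff₀ h2, div_le_iff₀ h2]
      rw [Nat.floor_eq_iff (by have := h0 x; positivity), not_and_or, not_le, not_lt, mul_comm]
    rw [this]
    exact (hlt _).union (hle _)
  have hFm : ∀ n i, MeasurableSet (F n i) := fun n i => (hFG n i).measurableSet.of_compl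
  have hFd : ∀ n, Pairwise fun i j => Disjoint (F n i) (F n j) := fun n i j hij =>
    Set.disjoint_left.2 fun x hi hj => hij (Fin.ext (Eq.trans (Eq.symm hi) hj))
  have hev : ∀ n, {ω | ∀ i, ∀ x ∈ F n i, (t n i : EReal) ≤ V ω x} =
      {ω | ∀ x, (dyadicFloor n (φ x) : EReal) ≤ V ω x} := fun n => by
    ext ω
    constructor
    · intro H x
      exact H ⟨_, hN n x⟩ x rfl
    · rintro H i x hx
      have := H x
      rw [dyadicFloor, show ⌊2 ^ n * φ x⌋₊ = i from hx] at this
      exact this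
  have hint : ∀ n, ∑ i, t n i * Λ.real (F n i) = ∫ x, dyadicFloor n (φ x) ∂Λ := fun n => by
    have : (fun x => dyadicFloor n (φ x)) = fun x => ∑ i, (F n i).indicator (fun _ => t n i) x := by
      ext x
      rw [Finset.sum_eq_single ⟨_, hN n x⟩]
      · exact (indicator_of_mem (s := F n ⟨_, hN n x⟩) (a := x) rfl
          (fun _ => t n ⟨_, hN n x⟩)).symm
      · intro j _ hj
        exact indicator_of_notMem (s := F n j) (a := x) (fun hx => hj (Fin.ext (Eq.symm hx))) _
      · simp
    rw [this, integral_finsetSum _ fun i _ => (integrable_const _).indicator (hFm n i)]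
    refine Finset.sum_congr rfl fun i _ => ?_
    rw [integral_indicator_const _ (hFm n i), smul_eq_mul, mul_comm]
  have key := fun n => h.fSigma (N n) (F n) (hFG n) (hFd n) (t n) (ht n)
  simp_rw [hev, hint] at key
  -- The approximation is from below and increasing in `n`, so the events decrease exactly to the
  -- limit event.
  have hE : {ω | ∀ x, (φ x : EReal) ≤ V ω x} =
      ⋂ n, {ω | ∀ x, (dyadicFloor n (φ x) : EReal) ≤ V ω x} := by
    ext ω
    simp only [mem_ofPred_eq, mem_iInter]
    refine ⟨fun H n x => (EReal.coe_le_coe_iff.2 (dyadicFloor_le (h0 x) n)).trans (H x),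
      fun H x => ?_⟩
    exact le_of_tendsto ((continuous_coe_real_ereal.tendsto _).comp (tendsto_dyadicFloor (h0 x)))
      (Filter.Eventually.of_forall fun n => H n x)
  rw [hE]
  refine ⟨MeasurableSet.iInter fun n => (key n).1, ?_⟩
  refine tendsto_nhds_unique (tendsto_measureReal_iInter_of_antitone (fun n => (key n).1)
    fun m n hmn ω hω x => (EReal.coe_le_coe_iff.2 (dyadicFloor_mono (h0 x) hmn)).trans (hω x)) ?_
  simp_rw [(key _).2]
  refine (Real.continuous_exp.tendsto _).comp (Filter.Tendsto.neg ?_)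
  refine tendsto_integral_of_dominated_convergence (fun _ => M) (fun n => ?_)
    (integrable_const _) (fun n => ?_) (Filter.Eventually.of_forall fun x => tendsto_dyadicFloor (h0 x))
  · unfold dyadicFloor
    have : Measurable fun x => ⌊2 ^ n * φ x⌋₊ := Nat.measurable_floor.comp (hφm.const_mul _)
    exact ((measurable_from_top (f := fun k : ℕ => (k : ℝ))).comp this |>.div_const _).aestronglyMeasurable
  · refine Filter.Eventually.of_forall fun x => ?_
    rw [Real.norm_of_nonneg (dyadicFloor_nonneg _ _)]
    exact (dyadicFloor_le (h0 x) n).trans (hM x)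

end Avoidance

/-! ### Mass of sublevel sets. -/

section LevelMass

variable {K : Type*} [MeasurableSpace K]

/-- The measure of the part of `S` on which `g ≤ u`. -/
noncomputable def levelMass (Λ : Measure K) (g : K → EReal) (S : Set K) (u : ℝ) : ℝ := Λ.real (S ∩ {x | g x ≤ u})

variable {Λ : Measure K} {g : K → EReal} {S : Set K}

theorem levelMass_nonneg (u : ℝ) : 0 ≤ levelMass Λ g S u := measureReal_nonneg

theorem levelMass_eq_zero {b u : ℝ} (hb : ∀ x, (b : EReal) ≤ g x) (hu : u < b) :
    levelMass Λ g S u = 0 := by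
  have : S ∩ {x | g x ≤ u} = ∅ := by
    ext x
    simpa using fun _ => (EReal.coe_lt_coe_iff.2 hu).trans_le (hb x)
  rw [levelMass, this, measureReal_empty]

variable [IsFiniteMeasure Λ]

theorem levelMass_mono : Monotone (levelMass Λ g S) := fun a b hab =>
  measureReal_mono (inter_subset_inter_right _ fun x hx =>
    le_trans hx (EReal.coe_le_coe_iff.2 hab))

theorem levelMass_add_compl (hS : MeasurableSet S) (u : ℝ) :
    levelMass Λ g S u + levelMass Λ g Sᶜ u = levelMass Λ g univ u := by
  have := measureReal_inter_add_sdiff (μ := Λ) (s := {x | g x ≤ u}) hS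
  rw [levelMass, levelMass, levelMass, univ_inter, ← this, inter_comm, inter_comm Sᶜ]
  rfl

end LevelMass

/-! ### The truncated difference and the layer-cake formula. -/

section Excess

variable {K : Type*}

/-- The positive part of `s - g x`. -/
noncomputable def excess (g : K → EReal) (s : ℝ) (x : K) : ℝ := (max ((s : EReal) - g x) 0).toReal

theorem excess_nonneg (g : K → EReal) (s : ℝ) (x : K) : 0 ≤ excess g s x :=
  EReal.toReal_nonneg (le_max_right _ _)

theorem excess_of_eq_top {g : K → EReal} {x : K} (h : g x = ⊤) (s : ℝ) : excess g s x = 0 := by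
  simp [excess, h]

theorem excess_of_eq_coe {g : K → EReal} {x : K} {r : ℝ} (h : g x = r) (s : ℝ) :
    excess g s x = max (s - r) 0 := by
  rw [excess, h, ← EReal.coe_sub, ← EReal.coe_zero, ← EReal.coe_strictMono.monotone.map_max,
    EReal.toReal_coe]

theorem EReal.eq_coe_or_eq_top {y : EReal} (h : y ≠ ⊥) : (∃ r : ℝ, y = r) ∨ y = ⊤ := by
  induction y with
  | bot => exact absurd rfl h
  | coe r => exact Or.inl ⟨r, rfl⟩
  | top => exact Or.inr rfl

/-- Nonnegativity of `v` absorbs the truncation at `0`; where `g x = ⊤` both sides hold trivially.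
-/
theorem excess_le_iff {g : K → EReal} {x : K} (h : g x ≠ ⊥) (s : ℝ) {v : EReal} (hv : 0 ≤ v) :
    (excess g s x : EReal) ≤ v ↔ (s : EReal) ≤ v + g x := by
  have hvb : v ≠ ⊥ := fun H => by simp [H] at hv
  rcases EReal.eq_coe_or_eq_top h with ⟨r, hr⟩ | hr
  · rw [excess_of_eq_coe hr, hr]
    rcases EReal.eq_coe_or_eq_top hvb with ⟨w, rfl⟩ | rfl
    · rw [EReal.coe_le_coe_iff, ← EReal.coe_add, EReal.coe_le_coe_iff]
      have : 0 ≤ w := by exact_mod_cast hv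
      rw [max_le_iff]
      constructor
      · rintro ⟨h1, -⟩; linarith
      · intro h1; exact ⟨by linarith, this⟩
    · simp
  · rw [excess_of_eq_top hr, hr, EReal.add_top_of_ne_bot hvb]
    simpa using hv

/-- For `a > 0` the truncation is invisible. Superlevel sets of the excess thus become sublevel sets
of `g`, which are closed. -/
theorem le_excess_iff {g : K → EReal} {x : K} (h : g x ≠ ⊥) (s : ℝ) {a : ℝ} (ha : 0 < a) :
    a ≤ excess g s x ↔ g x ≤ ((s - a : ℝ) : EReal) := by
  rcases EReal.eq_coe_or_eq_top h with ⟨r, hr⟩ | hr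
  · rw [excess_of_eq_coe hr, hr, EReal.coe_le_coe_iff, le_max_iff]
    constructor
    · rintro (h1 | h1) <;> linarith
    · intro h1; left; linarith
  · rw [excess_of_eq_top hr, hr, top_le_iff]
    exact iff_of_false ha.not_ge (EReal.coe_ne_top _)

theorem excess_le {g : K → EReal} {x : K} {b : ℝ} (h : (b : EReal) ≤ g x) (s : ℝ) :
    excess g s x ≤ max (s - b) 0 := by
  rcases EReal.eq_coe_or_eq_top (fun H => by simp [H] at h : g x ≠ ⊥) with ⟨r, hr⟩ | hr
  · rw [excess_of_eq_coe hr]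
    rw [hr, EReal.coe_le_coe_iff] at h
    gcongr
  · rw [excess_of_eq_top hr]
    exact le_max_right _ _

theorem ofReal_excess {g : K → EReal} {x : K} (h : g x ≠ ⊥) (s : ℝ) :
    ENNReal.ofReal (excess g s x) = volume ({u : ℝ | g x ≤ u} ∩ Iic s) := by
  rcases EReal.eq_coe_or_eq_top h with ⟨r, hr⟩ | hr
  · have : {u : ℝ | g x ≤ u} ∩ Iic s = Icc r s := by
      ext u; simp [hr]
    rw [excess_of_eq_coe hr, this, Real.volume_Icc, ENNReal.ofReal_max]
    simp
  · simp [excess_of_eq_top hr, hr]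

variable [TopologicalSpace K]

theorem exists_coe_le [CompactSpace K] {g : K → EReal} (hg : LowerSemicontinuous g)
    (hb : ∀ x, g x ≠ ⊥) : ∃ b : ℝ, ∀ x, (b : EReal) ≤ g x := by
  rcases isEmpty_or_nonempty K with hK | hK
  · exact ⟨0, fun x => hK.elim x⟩
  · obtain ⟨x, -, hx⟩ := (hg.lowerSemicontinuousOn univ).exists_isMinOn univ_nonempty isCompact_univ
    rcases EReal.eq_coe_or_eq_top (hb x) with ⟨r, hr⟩ | hr
    · exact ⟨r, fun y => hr ▸ hx (mem_univ y)⟩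
    · exact ⟨0, fun y => le_trans (by simp [hr]) (hx (mem_univ y))⟩

theorem isClosed_le_excess {g : K → EReal} (hg : LowerSemicontinuous g)
    (hb : ∀ x, g x ≠ ⊥) (s a : ℝ) : IsClosed {x | a ≤ excess g s x} := by
  rcases le_or_gt a 0 with ha | ha
  · convert isClosed_univ
    exact eq_univ_of_forall fun x => ha.trans (excess_nonneg g s x)
  · simp_rw [le_excess_iff (hb _) s ha]
    exact hg.isClosed_preimage _

variable [MeasurableSpace K] [BorelSpace K]

theorem measurable_excess {g : K → EReal} (hg : LowerSemicontinuous g)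
    (hb : ∀ x, g x ≠ ⊥) (s : ℝ) : Measurable (excess g s) :=
  measurable_of_Ici fun a => (isClosed_le_excess hg hb s a).measurableSet

theorem measurableSet_epigraph {g : K → EReal} (hg : LowerSemicontinuous g) :
    MeasurableSet {p : K × ℝ | g p.1 ≤ p.2} :=
  measurableSet_le (hg.measurable.comp measurable_fst)
    (measurable_coe_real_ereal.comp measurable_snd)

variable {Λ : Measure K} [IsFiniteMeasure Λ] {g : K → EReal} {S : Set K}

/-- The sets `{g ≤ r}` decrease to `{g ≤ u}` as `r ↓ u`, and `Λ` is finite. This supplies the right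
derivative of the integrated mass even where the mass jumps. -/
theorem levelMass_rightCont (hg : LowerSemicontinuous g) (hS : MeasurableSet S) (u : ℝ) :
    ContinuousWithinAt (levelMass Λ g S) (Ioi u) u := by
  have h := tendsto_measure_biInter_gt (μ := Λ) (s := fun r : ℝ => S ∩ {x | g x ≤ r}) (a := u)
    (fun r _ => (hS.inter (hg.isClosed_preimage _).measurableSet).nullMeasurableSet)
    (fun i j _ hij => inter_subset_inter_right _ fun x hx =>
      le_trans hx (EReal.coe_le_coe_iff.2 hij))
    ⟨u + 1, by simp, measure_ne_top _ _⟩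
  have h2 : ⋂ r > u, S ∩ {x | g x ≤ (r : ℝ)} = S ∩ {x | g x ≤ u} := by
    ext x
    simp only [mem_iInter, mem_inter_iff, mem_ofPred_eq]
    constructor
    · intro H
      refine ⟨(H (u + 1) (by simp)).1, EReal.le_of_forall_lt_iff_le.1 fun z hz => ?_⟩
      exact (H z (EReal.coe_lt_coe_iff.1 hz)).2
    · rintro ⟨h1, h2⟩ r hr
      exact ⟨h1, h2.trans (EReal.coe_le_coe_iff.2 (le_of_lt hr))⟩
  rw [h2] at h
  exact (ENNReal.tendsto_toReal (measure_ne_top _ _)).comp h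

/-- By Tonelli, both sides are the product measure of the region `x ∈ S`, `g x ≤ u ≤ s`, sliced in
the two orders. -/
theorem integral_excess (hg : LowerSemicontinuous g) (hb : ∀ x, g x ≠ ⊥)
    (s : ℝ) :
    ∫ x in S, excess g s x ∂Λ = ∫ u in Iic s, levelMass Λ g S u := by
  rw [integral_eq_lintegral_of_nonneg_ae (Filter.Eventually.of_forall (excess_nonneg g s))
      (measurable_excess hg hb s).aestronglyMeasurable,
    integral_eq_lintegral_of_nonneg_ae (Filter.Eventually.of_forall levelMass_nonneg)
      levelMass_mono.measurable.aestronglyMeasurable]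
  congr 1
  have hE := measurableSet_epigraph hg
  calc ∫⁻ x in S, ENNReal.ofReal (excess g s x) ∂Λ
      = ∫⁻ x in S, (volume.restrict (Iic s)) (Prod.mk x ⁻¹' {p : K × ℝ | g p.1 ≤ p.2}) ∂Λ := by
        refine lintegral_congr fun x => ?_
        rw [ofReal_excess (hb x), Measure.restrict_apply (measurable_prodMk_left hE)]
        rfl
    _ = ((Λ.restrict S).prod (volume.restrict (Iic s))) {p : K × ℝ | g p.1 ≤ p.2} :=
        (Measure.prod_apply hE).symm
    _ = ∫⁻ u in Iic s, (Λ.restrict S) ((fun x => (x, u)) ⁻¹' {p : K × ℝ | g p.1 ≤ p.2}) :=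
        Measure.prod_apply_symm hE
    _ = ∫⁻ u in Iic s, ENNReal.ofReal (levelMass Λ g S u) := by
        refine lintegral_congr fun u => ?_
        rw [Measure.restrict_apply (measurable_prodMk_right hE), levelMass, ofReal_measureReal,
          inter_comm]
        rfl

end Excess

/-! ### Calculus of `exp(-∫ m)` for monotone `m`. -/

section SurvivalAnalysis

variable {m : ℝ → ℝ} {b : ℝ}

theorem integrableOn_Iic_of_monotone (hm : Monotone m) (h0 : ∀ u < b, m u = 0) (s : ℝ) :
    IntegrableOn m (Iic s) := by
  have h1 : IntegrableOn m (Iio b) :=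
    integrableOn_zero.congr_fun (fun u hu => (h0 u hu).symm) measurableSet_Iio
  have h2 : IntegrableOn m (Icc b s) := (hm.monotoneOn _).integrableOn_isCompact isCompact_Icc
  refine (h1.union h2).mono_set fun u hu => ?_
  rcases lt_or_ge u b with h | h
  · exact Or.inl h
  · exact Or.inr ⟨h, hu⟩

theorem integral_Iic_eq (hm : Monotone m) (h0 : ∀ u < b, m u = 0) (a s : ℝ) :
    ∫ u in Iic s, m u = (∫ u in Iic a, m u) + ∫ u in a..s, m u := by
  rw [← intervalIntegral.integral_Iic_sub_Iic (integrableOn_Iic_of_monotone hm h0 a)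
    (integrableOn_Iic_of_monotone hm h0 s)]
  ring

theorem continuous_integral_Iic (hm : Monotone m) (h0 : ∀ u < b, m u = 0) :
    Continuous fun s => ∫ u in Iic s, m u := by
  rw [funext fun s => integral_Iic_eq hm h0 b s]
  exact continuous_const.add
    (intervalIntegral.continuous_primitive (fun a c => hm.intervalIntegrable) b)

/-- Since `m` may jump, only right derivatives are available; for a continuous primitive they
suffice in the fundamental theorem of calculus. -/
theorem lintegral_Ico_density (hm : Monotone m) (h0 : ∀ u < b, m u = 0) (hnn : ∀ u, 0 ≤ m u)
    (hr : ∀ u, ContinuousWithinAt m (Ioi u) u) {a c : ℝ} (hac : a ≤ c) :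
    ∫⁻ u in Ico a c, ENNReal.ofReal (m u * Real.exp (-∫ v in Iic u, m v)) =
      ENNReal.ofReal (Real.exp (-∫ v in Iic a, m v) - Real.exp (-∫ v in Iic c, m v)) := by
  have hc := continuous_integral_Iic hm h0
  have hint : IntervalIntegrable (fun u => m u * Real.exp (-∫ v in Iic u, m v)) volume a c :=
    hm.intervalIntegrable.mul_continuousOn (Real.continuous_exp.comp hc.neg).continuousOn
  have hd : ∀ u, HasDerivWithinAt (fun s => -Real.exp (-∫ v in Iic s, m v))
      (m u * Real.exp (-∫ v in Iic u, m v)) (Ioi u) u := fun u => by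
    have h1 : HasDerivWithinAt (fun s => ∫ v in Iic s, m v) (m u) (Ioi u) u := by
      rw [funext fun s => integral_Iic_eq hm h0 b s]
      refine HasDerivWithinAt.const_add _ ?_
      exact (intervalIntegral.integral_hasDerivWithinAt_right hm.intervalIntegrable
        (s := Ici u) (t := Ioi u) hm.measurable.stronglyMeasurable.stronglyMeasurableAtFilter
        (hr u)).mono Ioi_subset_Ici_self
    refine h1.neg.exp.neg.congr_deriv ?_
    simp only [Pi.neg_apply]
    ring
  have key := intervalIntegral.integral_eq_sub_of_hasDeriv_right
    (Real.continuous_exp.comp hc.neg).neg.continuousOn (fun u _ => hd u) hint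
  rw [intervalIntegral.integral_of_le hac, ← integral_Ico_eq_integral_Ioc] at key
  rw [← ofReal_integral_eq_lintegral_ofReal, key]
  · congr 1
    simp only [Function.comp, Pi.neg_apply]
    ring
  · rw [intervalIntegrable_iff_integrableOn_Ico_of_le hac] at hint
    exact hint
  · exact Filter.Eventually.of_forall fun u => mul_nonneg (hnn u) (Real.exp_pos _).le

/-- Beyond `a` the integral grows at least linearly, with slope `m a`. -/
theorem tendsto_exp_neg_integral_Iic (hm : Monotone m) (h0 : ∀ u < b, m u = 0) {a : ℝ}
    (ha : 0 < m a) :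
    Filter.Tendsto (fun s : ℝ => Real.exp (-∫ u in Iic s, m u)) Filter.atTop (nhds 0) := by
  refine Real.tendsto_exp_neg_atTop_nhds_zero.comp ?_
  have h1 : Filter.Tendsto (fun s : ℝ => (∫ u in Iic a, m u) + (s - a) * m a)
      Filter.atTop Filter.atTop :=
    Filter.tendsto_atTop_add_const_left _ _
      ((Filter.tendsto_atTop_add_const_right _ _ Filter.tendsto_id).atTop_mul_const ha)
  refine Filter.tendsto_atTop_mono' _ ?_ h1
  filter_upwards [Filter.eventually_ge_atTop a] with s hs
  rw [integral_Iic_eq hm h0 a s]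
  gcongr
  have : ∫ u in a..s, m a = (s - a) * m a := by simp
  rw [← this]
  exact intervalIntegral.integral_mono_on hs (by simp) hm.intervalIntegrable
    fun u hu => hm hu.1

end SurvivalAnalysis

/-! ### Measurability and independence tested on half-lines with real endpoints. -/

theorem borel_ereal_eq_generateFrom_Ici_coe :
    EReal.measurableSpace =
      MeasurableSpace.generateFrom (range fun r : ℝ => Ici (r : EReal)) := by
  apply le_antisymm
  · rw [BorelSpace.measurable_eq (α := EReal), borel_eq_generateFrom_Ioi]
    refine MeasurableSpace.generateFrom_le ?_
    rintro _ ⟨a, rfl⟩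
    have : Ioi a = ⋃ q : {q : ℚ // a < ((q : ℝ) : EReal)}, Ici (((q : ℚ) : ℝ) : EReal) := by
      ext x
      simp only [mem_Ioi, mem_iUnion, mem_Ici, Subtype.exists, exists_prop]
      constructor
      · intro h
        obtain ⟨q, h1, h2⟩ := EReal.lt_iff_exists_rat_btwn.1 h
        exact ⟨q, h1, h2.le⟩
      · rintro ⟨q, h1, h2⟩
        exact h1.trans_le h2
    rw [this]
    exact MeasurableSet.iUnion fun q => MeasurableSpace.measurableSet_generateFrom ⟨_, rfl⟩
  · refine MeasurableSpace.generateFrom_le ?_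
    rintro _ ⟨r, rfl⟩
    exact measurableSet_Ici

theorem isPiSystem_Ici_coe : IsPiSystem (range fun r : ℝ => Ici (r : EReal)) := by
  rintro _ ⟨a, rfl⟩ _ ⟨b, rfl⟩ -
  exact ⟨max a b, by
    simp only [Ici_inter_Ici, EReal.coe_strictMono.monotone.map_max]⟩

section

variable {Ω : Type*} [MeasurableSpace Ω]

theorem measurable_of_Ici_coe {A : Ω → EReal}
    (h : ∀ r : ℝ, MeasurableSet {ω | (r : EReal) ≤ A ω}) : Measurable A := by
  rw [borel_ereal_eq_generateFrom_Ici_coe]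
  refine measurable_generateFrom ?_
  rintro _ ⟨r, rfl⟩
  exact h r

theorem indepFun_of_Ici_coe {P : Measure Ω} [IsProbabilityMeasure P] {A B : Ω → EReal}
    (hA : Measurable A) (hB : Measurable B)
    (h : ∀ s t : ℝ, P ({ω | (s : EReal) ≤ A ω} ∩ {ω | (t : EReal) ≤ B ω}) =
      P {ω | (s : EReal) ≤ A ω} * P {ω | (t : EReal) ≤ B ω}) : IndepFun A B P := by
  rw [IndepFun_iff_Indep]
  refine IndepSets.indep hA.comap_le hB.comap_le (isPiSystem_Ici_coe.comap A)
    (isPiSystem_Ici_coe.comap B) ?_ ?_ ?_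
  · conv_lhs => rw [borel_ereal_eq_generateFrom_Ici_coe, MeasurableSpace.comap_generateFrom]
    rfl
  · conv_lhs => rw [borel_ereal_eq_generateFrom_Ici_coe, MeasurableSpace.comap_generateFrom]
    rfl
  · rw [IndepSets_iff]
    rintro _ _ ⟨_, ⟨s, rfl⟩, rfl⟩ ⟨_, ⟨t, rfl⟩, rfl⟩
    exact h s t

end

/-! ### Survival functions of the infima. -/

/-- The probability that the random function plus `g` exceeds `s` throughout `S`. -/
noncomputable def levelSurvival {K : Type*} [MeasurableSpace K] (Λ : Measure K) (g : K → EReal)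
    (S : Set K) (s : ℝ) : ℝ :=
  Real.exp (-∫ u in Iic s, levelMass Λ g S u)

/-- The infimum of `V ω + g` over `S`. -/
noncomputable def infAdd {K Ω : Type*} (V : Ω → K → EReal) (g : K → EReal) (S : Set K)
    (ω : Ω) : EReal :=
  ⨅ x ∈ S, (V ω x + g x)

theorem coe_le_infAdd_iff {K Ω : Type*} {V : Ω → K → EReal} {g : K → EReal} {S : Set K} {ω : Ω}
    {s : EReal} : s ≤ infAdd V g S ω ↔ ∀ x ∈ S, s ≤ V ω x + g x := by
  simp [infAdd]

section LevelSurvival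

variable {K : Type*} [MeasurableSpace K] {Λ : Measure K} {g : K → EReal} {S : Set K}

theorem levelSurvival_pos (s : ℝ) : 0 < levelSurvival Λ g S s := Real.exp_pos _

theorem levelSurvival_of_lt {b s : ℝ} (hb : ∀ x, (b : EReal) ≤ g x) (hs : s < b) :
    levelSurvival Λ g S s = 1 := by
  rw [levelSurvival, setIntegral_eq_zero_of_forall_eq_zero, neg_zero, Real.exp_zero]
  intro u hu
  exact levelMass_eq_zero hb (lt_of_le_of_lt hu hs)

variable [IsFiniteMeasure Λ]

theorem levelSurvival_mul_compl {b : ℝ} (hb : ∀ x, (b : EReal) ≤ g x) (hS : MeasurableSet S)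
    (s : ℝ) :
    levelSurvival Λ g S s * levelSurvival Λ g Sᶜ s = levelSurvival Λ g univ s := by
  rw [levelSurvival, levelSurvival, levelSurvival, ← Real.exp_add, ← neg_add, ← integral_add
    (integrableOn_Iic_of_monotone levelMass_mono (fun u hu => levelMass_eq_zero hb hu) s)
    (integrableOn_Iic_of_monotone levelMass_mono (fun u hu => levelMass_eq_zero hb hu) s)]
  simp_rw [levelMass_add_compl hS]

theorem levelSurvival_continuous {b : ℝ} (hb : ∀ x, (b : EReal) ≤ g x) :
    Continuous (levelSurvival Λ g S) :=
  Real.continuous_exp.comp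
    (continuous_integral_Iic levelMass_mono (fun _ => levelMass_eq_zero hb)).neg

end LevelSurvival

/-! ### Laws and independence of the infima over a set and its complement. -/

section InfLaw

variable {K Ω : Type*} [MetricSpace K] [CompactSpace K] [MeasurableSpace K] [BorelSpace K]
  [MeasurableSpace Ω] {Λ : Measure K} [IsFiniteMeasure Λ] {P : Measure Ω}
  {V : Ω → K → EReal} {g : K → EReal} {S : Set K}

namespace IsExpInfProcess

/-- The two events together say that `V` dominates one function, glued from the excesses at `s` and
`t`. Because `S` and `Sᶜ` are both Gδ, gluing keeps the sub- and superlevel sets Gδ, and the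
exponent splits over `S` and `Sᶜ`. -/
theorem joint_survival [IsFiniteMeasure P] (h : IsExpInfProcess Λ P V) (hg : LowerSemicontinuous g)
    (hgb : ∀ x, g x ≠ ⊥) (hS : IsGδ S) (hS' : IsGδ Sᶜ) (s t : ℝ) :
    MeasurableSet ({ω | (s : EReal) ≤ infAdd V g S ω} ∩ {ω | (t : EReal) ≤ infAdd V g Sᶜ ω}) ∧
    P.real ({ω | (s : EReal) ≤ infAdd V g S ω} ∩ {ω | (t : EReal) ≤ infAdd V g Sᶜ ω}) =
      levelSurvival Λ g S s * levelSurvival Λ g Sᶜ t := by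
  classical
  obtain ⟨b, hb⟩ := exists_coe_le hg hgb
  let φ : K → ℝ := S.piecewise (excess g s) (excess g t)
  have hφS : ∀ x ∈ S, φ x = excess g s x := fun x hx => piecewise_eq_of_mem _ _ _ hx
  have hφS' : ∀ x ∈ Sᶜ, φ x = excess g t x := fun x hx => piecewise_eq_of_notMem _ _ _ hx
  have h0 : ∀ x, 0 ≤ φ x := fun x => by
    by_cases hx : x ∈ S
    · rw [hφS x hx]; exact excess_nonneg _ _ _
    · rw [hφS' x hx]; exact excess_nonneg _ _ _
  have hM : ∀ x, φ x ≤ max (max (s - b) 0) (max (t - b) 0) := fun x => by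
    by_cases hx : x ∈ S
    · rw [hφS x hx]; exact (excess_le (hb x) s).trans (le_max_left _ _)
    · rw [hφS' x hx]; exact (excess_le (hb x) t).trans (le_max_right _ _)
  have hcl : ∀ r a, IsClosed {x | a ≤ excess g r x} := isClosed_le_excess hg hgb
  have hpre : ∀ A : Set ℝ, {x | φ x ∈ A} =
      (S ∩ {x | excess g s x ∈ A}) ∪ (Sᶜ ∩ {x | excess g t x ∈ A}) := fun A => by
    ext x
    by_cases hx : x ∈ S
    · simp [hφS x hx, hx]
    · simp [hφS' x hx, hx]
  have hlt : ∀ a, IsGδ {x | φ x < a} := fun a => by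
    have hop : ∀ r, IsGδ {x | excess g r x ∈ Iio a} := fun r => by
      have := (hcl r a).isOpen_compl.isGδ
      convert this using 1
      ext x; simp
    exact (hpre (Iio a)) ▸ (hS.inter (hop s)).union (hS'.inter (hop t))
  have hle : ∀ a, IsGδ {x | a ≤ φ x} := fun a =>
    (hpre (Ici a)) ▸ (hS.inter (hcl s a).isGδ).union (hS'.inter (hcl t a).isGδ)
  have hev : {ω | (s : EReal) ≤ infAdd V g S ω} ∩ {ω | (t : EReal) ≤ infAdd V g Sᶜ ω} =
      {ω | ∀ x, (φ x : EReal) ≤ V ω x} := by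
    ext ω
    simp only [mem_inter_iff, mem_ofPred_eq, coe_le_infAdd_iff]
    constructor
    · rintro ⟨h1, h2⟩ x
      by_cases hx : x ∈ S
      · rw [hφS x hx, excess_le_iff (hgb x) s (h.nonneg ω x)]; exact h1 x hx
      · rw [hφS' x hx, excess_le_iff (hgb x) t (h.nonneg ω x)]; exact h2 x hx
    · intro H
      refine ⟨fun x hx => ?_, fun x hx => ?_⟩
      · rw [← excess_le_iff (hgb x) s (h.nonneg ω x), ← hφS x hx]; exact H x
      · rw [← excess_le_iff (hgb x) t (h.nonneg ω x), ← hφS' x hx]; exact H x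
  obtain ⟨h1, h2⟩ := h.prob_le h0 hM hlt hle
  rw [hev]
  refine ⟨h1, h2.trans ?_⟩
  have hSm := hS.measurableSet
  have hφm : Measurable φ := measurable_of_Iio fun a => (hlt a).measurableSet
  have hφi : Integrable φ Λ := Integrable.of_bound hφm.aestronglyMeasurable _
    (Filter.Eventually.of_forall fun x => by rw [Real.norm_of_nonneg (h0 x)]; exact hM x)
  rw [← integral_add_compl hSm hφi, setIntegral_congr_fun hSm hφS,
    setIntegral_congr_fun hSm.compl hφS', integral_excess hg hgb, integral_excess hg hgb, neg_add,
    Real.exp_add]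
  rfl

variable (h : IsExpInfProcess Λ P V) (hg : LowerSemicontinuous g) (hgb : ∀ x, g x ≠ ⊥)
include h hg hgb

theorem survival_infAdd [IsFiniteMeasure P] (hS : IsGδ S) (hS' : IsGδ Sᶜ) (s : ℝ) :
    MeasurableSet {ω | (s : EReal) ≤ infAdd V g S ω} ∧
    P.real {ω | (s : EReal) ≤ infAdd V g S ω} = levelSurvival Λ g S s := by
  obtain ⟨b, hb⟩ := exists_coe_le hg hgb
  -- A threshold strictly below the lower bound of `g` makes the second event certain, leaving the
  -- marginal.
  have h1 : {ω | ((b - 1 : ℝ) : EReal) ≤ infAdd V g Sᶜ ω} = univ := by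
    refine eq_univ_of_forall fun ω => coe_le_infAdd_iff.2 fun x _ => ?_
    have h2 : ((b - 1 : ℝ) : EReal) ≤ b := EReal.coe_le_coe_iff.2 (by linarith)
    exact h2.trans ((hb x).trans (le_add_of_nonneg_left (h.nonneg ω x)))
  have := h.joint_survival hg hgb hS hS' s (b - 1)
  rwa [h1, inter_univ, levelSurvival_of_lt hb (by linarith : b - 1 < b), mul_one] at this

theorem measurable_infAdd [IsFiniteMeasure P] (hS : IsGδ S) (hS' : IsGδ Sᶜ) :
    Measurable (infAdd V g S) :=
  measurable_of_Ici_coe fun r => (h.survival_infAdd hg hgb hS hS' r).1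

theorem indepFun_infAdd [IsProbabilityMeasure P] (hS : IsGδ S) (hS' : IsGδ Sᶜ) :
    IndepFun (infAdd V g S) (infAdd V g Sᶜ) P := by
  have hS'' : IsGδ Sᶜᶜ := by rwa [compl_compl]
  refine indepFun_of_Ici_coe (h.measurable_infAdd hg hgb hS hS')
    (h.measurable_infAdd hg hgb hS' hS'') fun s t => ?_
  rw [← ENNReal.toReal_eq_toReal_iff' (measure_ne_top _ _)
    (ENNReal.mul_ne_top (measure_ne_top _ _) (measure_ne_top _ _)), ENNReal.toReal_mul]
  exact ((h.joint_survival hg hgb hS hS' s t).2).trans (by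
    rw [← (h.survival_infAdd hg hgb hS hS' s).2, ← (h.survival_infAdd hg hgb hS' hS'' t).2]; rfl)

/-- The law of the infimum over `S`, on the real line. -/
theorem comap_coe_map_infAdd [IsFiniteMeasure P] (hS : IsGδ S) (hS' : IsGδ Sᶜ) :
    (P.map (infAdd V g S)).comap (Real.toEReal) = (volume : Measure ℝ).withDensity
      fun r => ENNReal.ofReal (levelMass Λ g S r * levelSurvival Λ g S r) := by
  obtain ⟨b, hb⟩ := exists_coe_le hg hgb
  have hA := h.measurable_infAdd hg hgb hS hS'
  have hmap : ∀ s : Set ℝ, (P.map (infAdd V g S)).comap (Real.toEReal) s =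
      P.map (infAdd V g S) (Real.toEReal '' s) := fun s =>
    EReal.measurableEmbedding_coe.comap_apply _ _
  -- Half-open intervals are differences of the events `s ≤ infAdd`; a possible atom at `⊤` is
  -- discarded by `comap`.
  refine Measure.ext_of_Ico' _ _ (fun a c _ => ?_) fun a c hac => ?_
  · rw [hmap]; exact measure_ne_top _ _
  · have h1 : Real.toEReal '' (Ico a c) = Ico (a : EReal) c := by simp
    have h2 : infAdd V g S ⁻¹' Ico (a : EReal) c =
        {ω | (a : EReal) ≤ infAdd V g S ω} \ {ω | (c : EReal) ≤ infAdd V g S ω} := by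
      ext ω; simp
    have h3 := h.survival_infAdd hg hgb hS hS'
    have hsub : {ω | (c : EReal) ≤ infAdd V g S ω} ⊆ {ω | (a : EReal) ≤ infAdd V g S ω} :=
      fun ω hω => le_trans (EReal.coe_le_coe_iff.2 hac.le) hω
    rw [hmap, h1, Measure.map_apply hA measurableSet_Ico, h2,
      withDensity_apply _ measurableSet_Ico]
    unfold levelSurvival
    rw [lintegral_Ico_density levelMass_mono
      (fun u hu => levelMass_eq_zero hb hu) levelMass_nonneg
      (levelMass_rightCont hg hS.measurableSet) hac.le, ← ofReal_measureReal,
      measureReal_sdiff hsub (h3 c).1,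
      (h3 a).2, (h3 c).2]
    rfl

theorem map_infAdd_singleton [IsFiniteMeasure P] (hS : IsGδ S) (hS' : IsGδ Sᶜ) (r : ℝ) :
    P.map (infAdd V g S) {(r : EReal)} = 0 := by
  have h1 := congrArg (fun μ => μ {r}) (h.comap_coe_map_infAdd hg hgb hS hS')
  simp only [EReal.measurableEmbedding_coe.comap_apply, image_singleton] at h1
  rw [h1]
  exact withDensity_absolutelyContinuous _ _ Real.volume_singleton

/-- Under the product law, the diagonal over the reals is null because the second factor has no real
atoms. -/
theorem ae_infAdd_ne [IsProbabilityMeasure P] (hS : IsGδ S) (hS' : IsGδ Sᶜ) :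
    ∀ᵐ ω ∂P, infAdd V g S ω ≠ infAdd V g Sᶜ ω ∨ infAdd V g S ω = ⊤ ∨ infAdd V g S ω = ⊥ := by
  have hS'' : IsGδ Sᶜᶜ := by rwa [compl_compl]
  have hA := h.measurable_infAdd hg hgb hS hS'
  have hB := h.measurable_infAdd hg hgb hS' hS''
  have hprod := (indepFun_iff_map_prod_eq_prod_map_map hA.aemeasurable hB.aemeasurable).1
    (h.indepFun_infAdd hg hgb hS hS')
  let T : Set (EReal × EReal) := {p | p.1 ≠ p.2 ∨ p.1 = ⊤ ∨ p.1 = ⊥}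
  have hT : MeasurableSet T :=
    (measurableSet_eq_fun measurable_fst measurable_snd).compl.union
      ((measurable_fst (measurableSet_singleton _)).union
        (measurable_fst (measurableSet_singleton _)))
  have key : ∀ᵐ p ∂(P.map fun ω => (infAdd V g S ω, infAdd V g Sᶜ ω)), p ∈ T := by
    rw [hprod]
    change (_ : Measure (EReal × EReal)) Tᶜ = 0
    rw [Measure.prod_apply hT.compl, lintegral_eq_zero_iff
      (measurable_measure_prodMk_left hT.compl)]
    refine Filter.Eventually.of_forall fun a => ?_
    induction a with
    | bot => simp [T]
    | top => simp [T]
    | coe r =>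
      refine measure_mono_null (fun x hx => ?_) (h.map_infAdd_singleton hg hgb hS' hS'' r)
      simp only [T, mem_preimage, mem_compl_iff, mem_ofPred_eq, not_or, not_not] at hx
      exact hx.1.symm
  exact ae_of_ae_map (hA.prodMk hB).aemeasurable key

/-- Condition on the value `r` of the infimum over `S`: its density is mass times survival for `S`,
and the independent infimum over `Sᶜ` exceeds `r` with the survival probability for `Sᶜ`. The two
survival factors multiply to that of the whole space. -/
theorem prob_infAdd_lt_compl [IsProbabilityMeasure P] (hS : IsGδ S) (hS' : IsGδ Sᶜ) (t : ℝ) :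
    P {ω | (t : EReal) ≤ infAdd V g S ω ∧ infAdd V g S ω < infAdd V g Sᶜ ω} =
      ∫⁻ r in Ici t, ENNReal.ofReal (levelMass Λ g S r * levelSurvival Λ g univ r) := by
  have hS'' : IsGδ Sᶜᶜ := by rwa [compl_compl]
  obtain ⟨b, hb⟩ := exists_coe_le hg hgb
  have hA := h.measurable_infAdd hg hgb hS hS'
  have hB := h.measurable_infAdd hg hgb hS' hS''
  have hprod := (indepFun_iff_map_prod_eq_prod_map_map hA.aemeasurable hB.aemeasurable).1
    (h.indepFun_infAdd hg hgb hS hS')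
  let T : Set (EReal × EReal) := {p | (t : EReal) ≤ p.1 ∧ p.1 < p.2}
  have hT : MeasurableSet T :=
    (measurableSet_le measurable_const measurable_fst).inter
      (measurableSet_lt measurable_fst measurable_snd)
  set α := P.map (infAdd V g S)
  set β := P.map (infAdd V g Sᶜ)
  have hsec : ∀ r : ℝ, β (Prod.mk (r : EReal) ⁻¹' T) =
      (Ici t).indicator (fun r => ENNReal.ofReal (levelSurvival Λ g Sᶜ r)) r := fun r => by
    by_cases hr : t ≤ r
    · rw [indicator_of_mem (show r ∈ Ici t from hr)]
      have h1 : Prod.mk (r : EReal) ⁻¹' T = Ici (r : EReal) \ {(r : EReal)} := by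
        ext x; simp [T, hr]
      rw [h1, measure_sdiff_null (h.map_infAdd_singleton hg hgb hS' hS'' r),
        Measure.map_apply hB measurableSet_Ici, ← (h.survival_infAdd hg hgb hS' hS'' r).2,
        ofReal_measureReal]
      rfl
    · rw [indicator_of_notMem (show r ∉ Ici t from hr)]
      have h1 : Prod.mk (r : EReal) ⁻¹' T = ∅ := by
        ext x; simp [T, hr]
      rw [h1, measure_empty]
  calc P {ω | (t : EReal) ≤ infAdd V g S ω ∧ infAdd V g S ω < infAdd V g Sᶜ ω}
      = (P.map fun ω => (infAdd V g S ω, infAdd V g Sᶜ ω)) T :=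
        (Measure.map_apply (hA.prodMk hB) hT).symm
    _ = ∫⁻ a, β (Prod.mk a ⁻¹' T) ∂α := by rw [hprod, Measure.prod_apply hT]
    -- Infinite values contribute nothing: `⊤` is never strictly smaller, and `⊥` is below `t`.
    _ = ∫⁻ a in range Real.toEReal, β (Prod.mk a ⁻¹' T) ∂α := by
        rw [← lintegral_indicator EReal.measurableEmbedding_coe.measurableSet_range]
        refine lintegral_congr fun a => ?_
        induction a with
        | bot => simp [T]
        | top => simp [T]
        | coe r => rw [indicator_of_mem (mem_range_self r)]
    _ = ∫⁻ r, β (Prod.mk (r : EReal) ⁻¹' T) ∂(α.comap Real.toEReal) := by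
        rw [← EReal.measurableEmbedding_coe.map_comap,
          EReal.measurableEmbedding_coe.lintegral_map]
    _ = ∫⁻ r in Ici t, ENNReal.ofReal (levelMass Λ g S r * levelSurvival Λ g univ r) := by
        have hGm : ∀ A : Set K, Measurable fun r => ENNReal.ofReal (levelSurvival Λ g A r) :=
          fun A => (levelSurvival_continuous hb).measurable.ennreal_ofReal
        simp_rw [hsec]
        rw [h.comap_coe_map_infAdd hg hgb hS hS', lintegral_withDensity_eq_lintegral_mul _
          (show Measurable fun r => ENNReal.ofReal (levelMass Λ g S r * levelSurvival Λ g S r) from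
            (levelMass_mono.measurable.mul (levelSurvival_continuous hb).measurable).ennreal_ofReal)
          ((hGm _).indicator measurableSet_Ici), ← lintegral_indicator measurableSet_Ici]
        refine lintegral_congr fun r => ?_
        by_cases hr : r ∈ Ici t
        · rw [Pi.mul_apply, indicator_of_mem hr, indicator_of_mem hr, ← ENNReal.ofReal_mul
            (mul_nonneg (levelMass_nonneg r) (levelSurvival_pos r).le), mul_assoc,
            levelSurvival_mul_compl hb hS.measurableSet]
        · rw [Pi.mul_apply, indicator_of_notMem hr, indicator_of_notMem hr, mul_zero]

end IsExpInfProcess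

end InfLaw

/-! ### Minima and minimizers of a sum. -/

theorem exists_levelMass_pos {K : Type*} [MeasurableSpace K] {Λ : Measure K} [IsFiniteMeasure Λ]
    {g : K → EReal} (h : Λ {x | g x ≠ ⊤} ≠ 0) : ∃ a : ℝ, 0 < levelMass Λ g univ a := by
  by_contra! H
  refine h (measure_mono_null (t := ⋃ n : ℕ, {x | g x ≤ ((n : ℝ) : EReal)}) (fun x hx => ?_)
    (measure_iUnion_null fun n => ?_))
  · obtain ⟨n, hn⟩ := exists_nat_ge (g x).toReal
    exact mem_iUnion.2 ⟨n, (EReal.le_coe_toReal hx).trans (EReal.coe_le_coe_iff.2 hn)⟩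
  · have := le_antisymm (H n) (levelMass_nonneg _)
    rwa [levelMass, univ_inter, measureReal_eq_zero_iff] at this

theorem lowerSemicontinuous_add {K : Type*} [TopologicalSpace K] {f g : K → EReal}
    (hf : LowerSemicontinuous f) (hfb : ∀ x, f x ≠ ⊥) (hg : LowerSemicontinuous g)
    (hgb : ∀ x, g x ≠ ⊥) : LowerSemicontinuous fun x => f x + g x :=
  hf.add' hg fun x => EReal.continuousAt_add (Or.inr (hgb x)) (Or.inl (hfb x))

theorem argminSet_nonempty {K : Type*} [TopologicalSpace K] [CompactSpace K] [Nonempty K]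
    {f : K → EReal} (hf : LowerSemicontinuous f) : (argminSet f).Nonempty := by
  obtain ⟨x, -, hx⟩ := (hf.lowerSemicontinuousOn univ).exists_isMinOn univ_nonempty isCompact_univ
  exact ⟨x, le_antisymm (le_iInf fun y => hx (mem_univ y)) (iInf_le _ x)⟩

theorem infAdd_univ {K Ω : Type*} (V : Ω → K → EReal) (g : K → EReal) (ω : Ω) :
    infAdd V g univ ω = minValue fun x => V ω x + g x := by
  simp [infAdd, minValue]

theorem minValue_le_infAdd {K Ω : Type*} (V : Ω → K → EReal) (g : K → EReal) (S : Set K) (ω : Ω) :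
    (minValue fun x => V ω x + g x) ≤ infAdd V g S ω :=
  le_iInf₂ fun x _ => iInf_le _ x

theorem infAdd_eq_minValue {K Ω : Type*} {V : Ω → K → EReal} {g : K → EReal} {S : Set K} {ω : Ω}
    {x : K} (hxS : x ∈ S) (hx : x ∈ argminSet fun x => V ω x + g x) :
    infAdd V g S ω = minValue fun x => V ω x + g x :=
  le_antisymm ((iInf₂_le x hxS).trans_eq hx) (minValue_le_infAdd V g S ω)

/-! ### Finiteness, uniqueness and joint law of the minimizer and the minimum. -/

section Argmin

variable {K Ω : Type*} [MetricSpace K] [CompactSpace K] [MeasurableSpace K] [BorelSpace K]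
  [MeasurableSpace Ω] {Λ : Measure K} [IsFiniteMeasure Λ] {P : Measure Ω} [IsProbabilityMeasure P]
  {V : Ω → K → EReal} {g : K → EReal}

namespace IsExpInfProcess

variable (h : IsExpInfProcess Λ P V) (hg : LowerSemicontinuous g) (hgb : ∀ x, g x ≠ ⊥)
include h hg hgb

/-- An infinite minimum lies in every event `s ≤ infAdd`, and their probabilities tend to `0`
because some sublevel set of `g` has positive mass. -/
theorem ae_minValue_ne_top (hgt : Λ {x | g x ≠ ⊤} ≠ 0) :
    ∀ᵐ ω ∂P, (minValue fun x => V ω x + g x) ≠ ⊤ := by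
  obtain ⟨b, hb⟩ := exists_coe_le hg hgb
  obtain ⟨a, ha⟩ := exists_levelMass_pos hgt
  have h1 := tendsto_exp_neg_integral_Iic levelMass_mono (fun _ => levelMass_eq_zero hb) ha
  have h2 : P.real {ω | (minValue fun x => V ω x + g x) = ⊤} ≤ 0 := by
    refine ge_of_tendsto' h1 fun s => ?_
    have h3 := (h.survival_infAdd hg hgb (S := univ) isOpen_univ.isGδ
      (by simp) s).2
    refine le_trans (measureReal_mono fun ω hω => ?_) h3.le
    have h4 : infAdd V g univ ω = ⊤ := by rw [infAdd_univ]; exact hω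
    simp [h4]
  have h3 := (measureReal_eq_zero_iff (μ := P)).1 (le_antisymm h2 measureReal_nonneg)
  rw [ae_iff]
  simpa using h3

omit [IsFiniteMeasure Λ] [BorelSpace K] [IsProbabilityMeasure P] in
theorem minValue_ne_bot (ω : Ω) : (minValue fun x => V ω x + g x) ≠ ⊥ := by
  obtain ⟨b, hb⟩ := exists_coe_le hg hgb
  intro H
  have : (b : EReal) ≤ minValue fun x => V ω x + g x :=
    le_iInf fun x => (hb x).trans (le_add_of_nonneg_left (h.nonneg ω x))
  simp [H] at this

/-- Almost surely there are no ties between an open or closed set and its complement. -/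
theorem ae_infAdd_ne_of_ne_top {S : Set K} (hS : IsGδ S) (hS' : IsGδ Sᶜ) :
    ∀ᵐ ω ∂P, infAdd V g S ω = infAdd V g Sᶜ ω → infAdd V g S ω = ⊤ := by
  filter_upwards [h.ae_infAdd_ne hg hgb hS hS'] with ω hω heq
  rcases hω with hω | hω | hω
  · exact absurd heq hω
  · exact hω
  · have := minValue_le_infAdd V g S ω
    rw [hω, le_bot_iff] at this
    exact absurd this (h.minValue_ne_bot hg hgb ω)

/-- Two minimizers would be separated by a basic open set, producing a finite tie between it and its
complement. A countable base leaves only countably many null events to exclude. -/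
theorem ae_subsingleton_argminSet (hgt : Λ {x | g x ≠ ⊤} ≠ 0) :
    ∀ᵐ ω ∂P, (argminSet fun x => V ω x + g x).Subsingleton := by
  have h1 : ∀ᵐ ω ∂P, ∀ U ∈ TopologicalSpace.countableBasis K,
      infAdd V g U ω = infAdd V g Uᶜ ω → infAdd V g U ω = ⊤ := by
    rw [ae_ball_iff (TopologicalSpace.countable_countableBasis K)]
    intro U hU
    have hUo := TopologicalSpace.isOpen_of_mem_countableBasis hU
    exact h.ae_infAdd_ne_of_ne_top hg hgb hUo.isGδ hUo.isClosed_compl.isGδ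
  filter_upwards [h1, h.ae_minValue_ne_top hg hgb hgt] with ω hω htop x hx y hy
  by_contra hxy
  obtain ⟨U, hU, hxU, hUy⟩ := (TopologicalSpace.isBasis_countableBasis K).exists_subset_of_mem_open
    (show x ∈ ({y}ᶜ : Set K) from hxy) isOpen_compl_singleton
  have hyU : y ∈ Uᶜ := fun H => hUy H rfl
  have e1 := infAdd_eq_minValue hxU hx
  have e2 := infAdd_eq_minValue hyU hy
  exact htop (e1 ▸ hω U hU (e1.trans e2.symm))

theorem ae_argminSet_eq_singleton (hV : ∀ ω, LowerSemicontinuous (V ω))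
    (hgt : Λ {x | g x ≠ ⊤} ≠ 0) :
    ∀ᵐ ω ∂P, ∃ x, (argminSet fun x => V ω x + g x) = {x} := by
  have : Nonempty K := (nonempty_of_measure_ne_zero hgt).to_subtype.map (·.1)
  filter_upwards [h.ae_subsingleton_argminSet hg hgb hgt] with ω hω
  obtain ⟨x, hx⟩ := argminSet_nonempty (lowerSemicontinuous_add (hV ω)
    (fun x H => by simpa [H] using h.nonneg ω x) hg hgb)
  exact ⟨x, hω.eq_singleton_of_mem hx⟩

variable {X : Ω → K} {τ : Ω → ℝ}

/-- Outside the null event of a finite tie, the minimizer lies in `C` exactly when `C` has the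
strictly smaller infimum, which is then `τ`. -/
theorem prob_argmin_mem (hX : ∀ᵐ ω ∂P, X ω ∈ (argminSet fun x => V ω x + g x) ∧
      (τ ω : EReal) = minValue fun x => V ω x + g x) {C : Set K} (hC : IsClosed C) (t : ℝ) :
    P {ω | X ω ∈ C ∧ t ≤ τ ω} =
      ∫⁻ r in Ici t, ENNReal.ofReal (levelMass Λ g C r * levelSurvival Λ g univ r) := by
  have hC' := hC.isOpen_compl.isGδ
  rw [← h.prob_infAdd_lt_compl hg hgb hC.isGδ hC' t]
  refine measure_congr ?_
  filter_upwards [hX, h.ae_infAdd_ne_of_ne_top hg hgb hC.isGδ hC'] with ω ⟨hω, hτ⟩ hne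
  refine propext ⟨?_, ?_⟩
  · rintro ⟨hXC, hle⟩
    have e := infAdd_eq_minValue hXC hω
    rw [← hτ] at e
    refine ⟨e ▸ EReal.coe_le_coe_iff.2 hle, lt_of_le_of_ne ?_ fun H => ?_⟩
    · rw [e, hτ]; exact minValue_le_infAdd V g _ ω
    · have := hne H
      rw [e] at this
      exact EReal.coe_ne_top _ this
  · rintro ⟨hle, hlt⟩
    have hXC : X ω ∈ C := by
      by_contra H
      exact (hlt.trans_le ((infAdd_eq_minValue (S := Cᶜ) H hω).trans_le
        (minValue_le_infAdd V g C ω))).false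
    refine ⟨hXC, EReal.coe_le_coe_iff.1 ?_⟩
    rw [hτ, ← infAdd_eq_minValue hXC hω]
    exact hle

omit h in
-- Integrate over space first at fixed `r`. Replacing `<` by `≤` costs only the graph of `g`, which
-- is null since each time-section has at most one point.
theorem withDensity_prod_Ici {C : Set K} (hC : IsClosed C) (t : ℝ) :
    ((Λ.prod (volume : Measure ℝ)).withDensity ({p : K × ℝ | g p.1 < p.2}.indicator
      fun p => ENNReal.ofReal (levelSurvival Λ g univ p.2))) (C ×ˢ Ici t) =
      ∫⁻ r in Ici t, ENNReal.ofReal (levelMass Λ g C r * levelSurvival Λ g univ r) := by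
  obtain ⟨b, hb⟩ := exists_coe_le hg hgb
  have hE := measurableSet_epigraph hg
  have hG : Measurable fun p : K × ℝ => ENNReal.ofReal (levelSurvival Λ g univ p.2) :=
    ((levelSurvival_continuous hb).measurable.comp measurable_snd).ennreal_ofReal
  have hnull : (Λ.prod (volume : Measure ℝ)) {p : K × ℝ | g p.1 = p.2} = 0 := by
    have hm : MeasurableSet {p : K × ℝ | g p.1 = p.2} :=
      measurableSet_eq_fun (hg.measurable.comp measurable_fst)
        (measurable_coe_real_ereal.comp measurable_snd)
    rw [Measure.measure_prod_null hm]
    refine Filter.Eventually.of_forall fun x => Set.Subsingleton.measure_zero (fun r hr s hs => ?_) _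
    exact EReal.coe_injective (Eq.trans (Eq.symm hr) hs)
  have hae : {p : K × ℝ | g p.1 < p.2}.indicator
      (fun p => ENNReal.ofReal (levelSurvival Λ g univ p.2)) =ᵐ[Λ.prod volume]
      {p : K × ℝ | g p.1 ≤ p.2}.indicator
        (fun p => ENNReal.ofReal (levelSurvival Λ g univ p.2)) := by
    refine indicator_ae_eq_of_ae_eq_set ?_
    filter_upwards [compl_mem_ae_iff.2 hnull] with p hp
    exact propext ⟨fun H => le_of_lt H, fun H => lt_of_le_of_ne H hp⟩
  rw [withDensity_congr_ae hae, withDensity_apply _ (hC.measurableSet.prod measurableSet_Ici),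
    ← Measure.prod_restrict, lintegral_prod_symm' _ (hG.indicator hE)]
  refine lintegral_congr fun r => ?_
  have : ∀ x, {p : K × ℝ | g p.1 ≤ p.2}.indicator
      (fun p => ENNReal.ofReal (levelSurvival Λ g univ p.2)) (x, r) =
      {x | g x ≤ r}.indicator (fun _ => ENNReal.ofReal (levelSurvival Λ g univ r)) x := fun x => rfl
  have hm : MeasurableSet {x | g x ≤ r} := (hg.isClosed_preimage _).measurableSet
  simp_rw [this]
  rw [lintegral_indicator_const hm, Measure.restrict_apply hm,
    ENNReal.ofReal_mul (levelMass_nonneg r), levelMass, ofReal_measureReal, mul_comm, inter_comm]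

/-- The joint law of the argmin and the minimum. -/
theorem map_argmin_minValue (hXm : AEMeasurable X P) (hτm : AEMeasurable τ P)
    (hX : ∀ᵐ ω ∂P, X ω ∈ (argminSet fun x => V ω x + g x) ∧
      (τ ω : EReal) = minValue fun x => V ω x + g x) :
    P.map (fun ω => (X ω, τ ω)) = (Λ.prod (volume : Measure ℝ)).withDensity
      ({p : K × ℝ | g p.1 < p.2}.indicator
        fun p => ENNReal.ofReal (levelSurvival Λ g univ p.2)) := by
  have hpm := hXm.prodMk hτm
  -- Products of closed sets and half-lines form a generating π-system; the strips `Ici (-n)`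
  -- exhaust the space with finite mass.
  refine Measure.ext_of_generateFrom_of_iUnion
    (image2 (fun (s : Set K) (t : Set ℝ) => s ×ˢ t) {C | IsClosed C} (range Ici))
    (fun n : ℕ => univ ×ˢ Ici (-n : ℝ)) ?_ ?_ ?_ ?_ ?_ ?_
  · refine (generateFrom_eq_prod ?_ ?_ ?_ ?_).symm
    · rw [BorelSpace.measurable_eq (α := K), borel_eq_generateFrom_isClosed]
    · rw [BorelSpace.measurable_eq (α := ℝ), borel_eq_generateFrom_Ici]
    · exact ⟨fun _ => univ, fun _ => isClosed_univ, iUnion_const _⟩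
    · refine ⟨fun n : ℕ => Ici (-n : ℝ), fun n => mem_range_self _, eq_univ_of_forall fun x => ?_⟩
      obtain ⟨n, hn⟩ := exists_nat_ge (-x)
      exact mem_iUnion.2 ⟨n, by simp only [mem_Ici]; linarith⟩
  · refine IsPiSystem.prod ?_ ?_
    · exact fun s hs t ht _ => IsClosed.inter hs ht
    · rintro _ ⟨a, rfl⟩ _ ⟨c, rfl⟩ -
      exact ⟨a ⊔ c, Ici_inter_Ici.symm⟩
  · refine eq_univ_of_forall fun p => ?_
    obtain ⟨n, hn⟩ := exists_nat_ge (-p.2)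
    exact mem_iUnion.2 ⟨n, mem_univ _, by simp only [mem_Ici]; linarith⟩
  · exact fun n => ⟨univ, isClosed_univ, _, mem_range_self _, rfl⟩
  · exact fun n => measure_ne_top _ _
  · rintro _ ⟨C, hC, _, ⟨t, rfl⟩, rfl⟩
    have hC : IsClosed C := hC
    rw [withDensity_prod_Ici hg hgb hC, Measure.map_apply_of_aemeasurable hpm
      (hC.measurableSet.prod measurableSet_Ici), ← h.prob_argmin_mem hg hgb hX hC t]
    rfl

end IsExpInfProcess

end Argmin

/-! ### Truncated exponential laws and measurability of infima. -/

theorem expMeasure_Ici {r t : ℝ} (hr : 0 < r) (ht : 0 ≤ t) :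
    expMeasure r (Ici t) = ENNReal.ofReal (Real.exp (-(t * r))) := by
  have := isProbabilityMeasure_expMeasure hr
  have h0 : expMeasure r {t} = 0 :=
    withDensity_absolutelyContinuous _ _ Real.volume_singleton
  have h1 : Ici t \ {t} = (Iic t)ᶜ := by
    ext u; simp
  rw [← measure_sdiff_null h0, h1, ← ofReal_measureReal,
    probReal_compl_eq_one_sub measurableSet_Iic, ← cdf_eq_real, cdf_expMeasure_eq hr, if_pos ht,
    mul_comm r t]
  ring_nf

theorem measurableSet_le_max (t : ℝ) : MeasurableSet {y : EReal | (t : EReal) ≤ max y 0} :=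
  measurableSet_le measurable_const (measurable_id.max measurable_const)

theorem expLaw_le_max {r t : ℝ} (hr : 0 ≤ r) (ht : 0 ≤ t) :
    expLaw r {y : EReal | (t : EReal) ≤ max y 0} = ENNReal.ofReal (Real.exp (-(t * r))) := by
  rcases hr.eq_or_lt with rfl | hr
  · rw [expLaw, if_pos rfl, Measure.dirac_apply' _ (measurableSet_le_max t)]
    simp
  · have := isProbabilityMeasure_expMeasure hr
    rw [expLaw, if_neg hr.ne', Measure.map_apply measurable_coe_real_ereal (measurableSet_le_max t)]
    -- At `t = 0` the truncated event is everything; for `t > 0` the truncation has no effect.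
    rcases ht.eq_or_lt with rfl | ht
    · simp
    · rw [← expMeasure_Ici hr ht.le]
      congr 1
      ext u
      have : ¬ (t : EReal) ≤ 0 := by simpa using ht
      simp [this]

theorem expLaw_Iio_zero {r : ℝ} (hr : 0 ≤ r) : expLaw r (Iio 0) = 0 := by
  rcases hr.eq_or_lt with rfl | hr
  · rw [expLaw, if_pos rfl, Measure.dirac_apply' _ measurableSet_Iio]
    simp
  · have := isProbabilityMeasure_expMeasure hr
    rw [expLaw, if_neg hr.ne', Measure.map_apply measurable_coe_real_ereal measurableSet_Iio]
    have h1 : (Real.toEReal ⁻¹' Iio 0) = (Ici 0)ᶜ := by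
      ext u; simp
    change expMeasure r (Real.toEReal ⁻¹' Iio 0) = 0
    rw [h1, prob_compl_eq_zero_iff measurableSet_Ici, expMeasure_Ici hr le_rfl]
    simp

/-- Strict lower bounds on a compact set define subbasic open sets; rational thresholds below `t`
recover the non-strict bound. -/
theorem measurable_iInf_of_isCompact {K : Type*} [TopologicalSpace K] {C : Set K}
    (hC : IsCompact C) : Measurable fun f : LSCFun K => ⨅ x ∈ C, f x := by
  refine measurable_of_Ici_coe fun t => ?_
  have h1 : {f : LSCFun K | (t : EReal) ≤ ⨅ x ∈ C, f x} =
      ⋂ q : {q : ℚ // (q : ℝ) < t}, {f : LSCFun K | (((q : ℚ) : ℝ) : EReal) < ⨅ x ∈ C, f x} := by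
    ext f
    rw [mem_iInter]
    constructor
    · intro H q
      exact lt_of_lt_of_le (EReal.coe_lt_coe_iff.2 q.2) H
    · intro H
      by_contra hlt
      obtain ⟨q, h2, h3⟩ := EReal.lt_iff_exists_rat_btwn.1 (not_le.1 hlt)
      exact (h2.trans (H ⟨q, EReal.coe_lt_coe_iff.1 h3⟩)).false
  rw [h1]
  refine MeasurableSet.iInter fun q => ?_
  have : IsOpen {f : LSCFun K | (((q : ℚ) : ℝ) : EReal) < ⨅ x ∈ C, f x} :=
    TopologicalSpace.isOpen_generateFrom_of_mem (Or.inr ⟨C, _, hC, rfl⟩)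
  exact MeasurableSpace.measurableSet_generateFrom this

theorem forall_le_max_iff {K : Type*} {f : K → EReal} {C : Set K} {t : ℝ} :
    (∀ x ∈ C, (t : EReal) ≤ max (f x) 0) ↔ (t : EReal) ≤ max (⨅ x ∈ C, f x) 0 := by
  simp only [le_max_iff, le_iInf_iff]
  by_cases h : (t : EReal) ≤ 0 <;> simp [h]

/-! ### From the process on the closed domain to the abstract setting. -/

section Domain

variable {d : ℕ} {D : Set (EuclideanSpace ℝ (Fin d))} {lam : closure D → ℝ}

theorem leb_apply (S : Set (closure D)) : leb D S = volume (Subtype.val '' S) :=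
  comap_subtype_coe_apply isClosed_closure.measurableSet _ S

theorem isFiniteMeasure_leb (hDb : Bornology.IsBounded D) : IsFiniteMeasure (leb D) :=
  ⟨by
    rw [leb_apply, image_univ, Subtype.range_coe]
    exact hDb.closure.measure_lt_top⟩

theorem leb_notMem (hDo : IsOpen D) (hDf : volume (frontier D) = 0) :
    leb D {x : closure D | (x : EuclideanSpace ℝ (Fin d)) ∈ D}ᶜ = 0 := by
  rw [leb_apply]
  refine measure_mono_null ?_ hDf
  rintro _ ⟨x, hx, rfl⟩
  rw [hDo.frontier_eq]
  exact ⟨x.2, hx⟩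

/-- The measure with density `λ` on `closure D`. -/
noncomputable def rateMeasure (D : Set (EuclideanSpace ℝ (Fin d))) (lam : closure D → ℝ) :
    Measure (closure D) :=
  (leb D).withDensity fun x => ENNReal.ofReal (lam x)

theorem integrable_rate [CompactSpace (closure D)] [IsFiniteMeasure (leb D)]
    (hlamc : Continuous lam) : Integrable lam (leb D) :=
  hlamc.integrable_of_hasCompactSupport (HasCompactSupport.of_compactSpace lam)

theorem isFiniteMeasure_rateMeasure (hlam : Integrable lam (leb D)) :
    IsFiniteMeasure (rateMeasure D lam) :=
  isFiniteMeasure_withDensity_ofReal hlam.2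

theorem rateMeasure_real (hlami : Integrable lam (leb D)) (hlam : ∀ x, 0 < lam x)
    {S : Set (closure D)} (hS : MeasurableSet S) :
    (rateMeasure D lam).real S = ∫ x in S, lam x ∂(leb D) := by
  rw [Measure.real, rateMeasure, withDensity_apply _ hS, integral_eq_lintegral_of_nonneg_ae
    (Filter.Eventually.of_forall fun x => (hlam x).le) hlami.1.restrict]

theorem leb_absolutelyContinuous_rateMeasure (hlamc : Continuous lam) (hlam : ∀ x, 0 < lam x) :
    leb D ≪ rateMeasure D lam :=
  withDensity_absolutelyContinuous' hlamc.measurable.ennreal_ofReal.aemeasurable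
    (Filter.Eventually.of_forall fun x => by simpa using hlam x)

theorem lamBar_pos (hDo : IsOpen D) (hDf : volume (frontier D) = 0)
    (hlamc : Continuous lam) (hlami : Integrable lam (leb D)) (hlam : ∀ x, 0 < lam x)
    (h : leb D univ ≠ 0) : 0 < lamBar D lam := by
  have hDm : MeasurableSet {x : closure D | (x : EuclideanSpace ℝ (Fin d)) ∈ D} :=
    measurable_subtype_coe hDo.measurableSet
  have := isFiniteMeasure_rateMeasure hlami
  rw [lamBar, ← rateMeasure_real hlami hlam hDm]
  refine ENNReal.toReal_pos (fun H => h ?_) (measure_ne_top _ _)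
  rw [← union_compl_self {x : closure D | (x : EuclideanSpace ℝ (Fin d)) ∈ D}]
  exact measure_union_null (leb_absolutelyContinuous_rateMeasure hlamc hlam H)
    (leb_notMem hDo hDf)

/-- The normalization cancels, and passing from `D` to its closure adds only the null frontier. -/
theorem lamBar_mul_H (hDo : IsOpen D) (hDf : volume (frontier D) = 0)
    (hpos : 0 < lamBar D lam) (g : closure D → EReal) (s : ℝ) :
    lamBar D lam * H D lam g s = levelMass (rateMeasure D lam) g univ s := by
  have h1 : muLam D lam = ENNReal.ofReal (lamBar D lam)⁻¹ • rateMeasure D lam := by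
    rw [muLam, rateMeasure, ← withDensity_smul' _ _ ENNReal.ofReal_ne_top]
    congr 1
    ext x
    rw [Pi.smul_apply, smul_eq_mul, ← ENNReal.ofReal_mul (inv_nonneg.2 hpos.le), div_eq_inv_mul]
  have h2 : (rateMeasure D lam).real {x : closure D | (x : EuclideanSpace ℝ (Fin d)) ∈ D ∧ g x ≤ s}
      = levelMass (rateMeasure D lam) g univ s := by
    rw [levelMass, univ_inter]
    refine measureReal_congr ?_
    have hac : rateMeasure D lam ≪ leb D := withDensity_absolutelyContinuous _ _
    filter_upwards [compl_mem_ae_iff.2 (hac (leb_notMem hDo hDf))] with x hx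
    exact propext ⟨fun hh => hh.2, fun hh => ⟨not_not.1 hx, hh⟩⟩
  rw [H, h1, measureReal_ennreal_smul_apply, h2, ENNReal.toReal_ofReal (inv_nonneg.2 hpos.le),
    mul_inv_cancel_left₀ hpos.ne']

theorem survival_eq_levelSurvival (hDo : IsOpen D) (hDf : volume (frontier D) = 0)
    (hpos : 0 < lamBar D lam) (g : closure D → EReal) (t : ℝ) :
    survival D lam g t = levelSurvival (rateMeasure D lam) g univ t := by
  rw [survival, levelSurvival, neg_mul, ← integral_const_mul]
  simp_rw [lamBar_mul_H hDo hDf hpos]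

variable {Ω : Type*} [MeasurableSpace Ω] {P : Measure Ω} {W : Ω → LSCFun (closure D)}

theorem IsExtremeValueProcess.measurable_iInf [CompactSpace (closure D)]
    (hW : IsExtremeValueProcess D lam P W) {C : Set (closure D)} (hC : IsClosed C) :
    Measurable fun ω => ⨅ x ∈ C, W ω x :=
  (measurable_iInf_of_isCompact hC.isCompact).comp hW.measurable

/-- Truncating at `0` gives nonnegativity for every `ω` without changing the probabilities at levels
`t ≥ 0`. -/
theorem IsExtremeValueProcess.isExpInfProcess [CompactSpace (closure D)]
    (hW : IsExtremeValueProcess D lam P W) (hlami : Integrable lam (leb D))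
    (hlam : ∀ x, 0 < lam x) :
    IsExpInfProcess (rateMeasure D lam) P fun ω x => max (W ω x) 0 where
  nonneg _ _ := le_max_right _ _
  measurableSet C hC t := by
    simp_rw [forall_le_max_iff]
    exact hW.measurable_iInf hC (measurableSet_le_max t)
  prob k C hC hd t ht := by
    have h1 := (hW.indep k C hC hd).measure_inter_preimage_eq_mul Finset.univ
      (sets := fun i => {y : EReal | (t i : EReal) ≤ max y 0}) fun i _ => measurableSet_le_max (t i)
    have h2 : ∀ i, P ((fun ω => ⨅ x ∈ C i, W ω x) ⁻¹' {y : EReal | (t i : EReal) ≤ max y 0}) =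
        ENNReal.ofReal (Real.exp (-(t i * (rateMeasure D lam).real (C i)))) := fun i => by
      rw [rateMeasure_real hlami hlam (hC i).measurableSet, ← expLaw_le_max
        (integral_nonneg fun x => (hlam x).le) (ht i), ← hW.exponential _ (hC i), Measure.map_apply
        (hW.measurable_iInf (hC i)) (measurableSet_le_max _)]
    have h3 : {ω | ∀ i, ∀ x ∈ C i, (t i : EReal) ≤ max (W ω x) 0} = ⋂ i ∈ Finset.univ,
        (fun ω => ⨅ x ∈ C i, W ω x) ⁻¹' {y : EReal | (t i : EReal) ≤ max y 0} := by
      ext ω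
      simp_rw [forall_le_max_iff]
      simp
    rw [h3, Measure.real, h1]
    simp_rw [h2]
    rw [← ENNReal.ofReal_prod_of_nonneg fun i _ => (Real.exp_pos _).le, ← Real.exp_sum,
      ENNReal.toReal_ofReal (Real.exp_pos _).le, Finset.sum_neg_distrib]

/-- The exponential law of the infimum over the whole space gives one null event that serves all
points at once. -/
theorem IsExtremeValueProcess.ae_nonneg [CompactSpace (closure D)]
    (hW : IsExtremeValueProcess D lam P W) (hlam : ∀ x, 0 < lam x) :
    ∀ᵐ ω ∂P, ∀ x, 0 ≤ W ω x := by
  have h1 := hW.exponential univ isClosed_univ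
  have h2 : P ((fun ω => ⨅ x ∈ univ, W ω x) ⁻¹' Iio 0) = 0 := by
    rw [← Measure.map_apply (hW.measurable_iInf isClosed_univ) measurableSet_Iio, h1]
    exact expLaw_Iio_zero (integral_nonneg fun x => (hlam x).le)
  filter_upwards [compl_mem_ae_iff.2 h2] with ω hω x
  have h3 : (0 : EReal) ≤ ⨅ x ∈ univ, W ω x := by simpa using hω
  exact h3.trans (iInf₂_le x (mem_univ x))

end Domain

/-! ### Marginal density of the minimizer. -/

section Density

variable {d : ℕ} {D : Set (EuclideanSpace ℝ (Fin d))} {lam : closure D → ℝ}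
  {g : closure D → EReal}

theorem ofReal_mul_Psi (hlam : ∀ x, 0 < lam x) (p : closure D × ℝ) :
    ENNReal.ofReal (lam p.1 * Psi D lam p.1 p.2 g) = ENNReal.ofReal (lam p.1) *
      {p : closure D × ℝ | g p.1 < p.2}.indicator
        (fun p => ENNReal.ofReal (survival D lam g p.2)) p := by
  rw [ENNReal.ofReal_mul (hlam _).le, Psi]
  by_cases h : g p.1 < p.2
  · rw [if_pos h, indicator_of_mem (show p ∈ {p : closure D × ℝ | g p.1 < p.2} from h)]
  · rw [if_neg h, indicator_of_notMem (show p ∉ {p : closure D × ℝ | g p.1 < p.2} from h),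
      ENNReal.ofReal_zero]

/-- Integrating out the time variable. -/
theorem lintegral_mul_Psi (hlam : ∀ x, 0 < lam x) (hs : Continuous (survival D lam g))
    (x : closure D) (hx : ∫⁻ t, ENNReal.ofReal (lam x * Psi D lam x t g) ≠ ⊤) :
    ∫⁻ t, ENNReal.ofReal (lam x * Psi D lam x t g) = ENNReal.ofReal (lam x * Phi D lam x g) := by
  have hm : MeasurableSet {t : ℝ | g x < t} :=
    measurableSet_lt measurable_const measurable_coe_real_ereal
  have h1 : ∫⁻ t, ENNReal.ofReal (lam x * Psi D lam x t g) =
      ENNReal.ofReal (lam x) * ∫⁻ t in {t : ℝ | g x < t}, ENNReal.ofReal (survival D lam g t) := by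
    rw [← lintegral_indicator hm, ← lintegral_const_mul' _ _ ENNReal.ofReal_ne_top]
    exact lintegral_congr fun t => ofReal_mul_Psi hlam (x, t)
  have h2 : ∫⁻ t in {t : ℝ | g x < t}, ENNReal.ofReal (survival D lam g t) ≠ ⊤ := fun H => by
    rw [h1, H, ENNReal.mul_top (by simpa using hlam x)] at hx
    exact hx rfl
  have h0 : ∀ t, 0 ≤ survival D lam g t := fun t => (Real.exp_pos _).le
  -- The Bochner integral in `Phi` would default to `0` without integrability; finiteness of the
  -- time integral rules this out.
  rw [h1, ENNReal.ofReal_mul (hlam x).le, Phi, ofReal_integral_eq_lintegral_ofReal _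
    (Filter.Eventually.of_forall h0)]
  refine (lintegral_ofReal_ne_top_iff_integrable hs.aestronglyMeasurable
    (Filter.Eventually.of_forall h0)).1 h2

theorem measurable_mul_Psi (hlamc : Continuous lam) (hlam : ∀ x, 0 < lam x)
    (hg : LowerSemicontinuous g) (hs : Continuous (survival D lam g)) :
    Measurable fun p : closure D × ℝ => ENNReal.ofReal (lam p.1 * Psi D lam p.1 p.2 g) := by
  rw [funext (ofReal_mul_Psi hlam)]
  refine (hlamc.measurable.comp measurable_fst).ennreal_ofReal.mul (Measurable.indicator
    (hs.measurable.comp measurable_snd).ennreal_ofReal ?_)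
  exact measurableSet_lt (hg.measurable.comp measurable_fst)
    (measurable_coe_real_ereal.comp measurable_snd)

/-- Finite total mass makes the time integral finite for almost every `x`, which is what identifies
it with `Phi`. -/
theorem map_fst_withDensity_mul_Psi [IsFiniteMeasure (leb D)] (hlamc : Continuous lam)
    (hlam : ∀ x, 0 < lam x) (hg : LowerSemicontinuous g) (hs : Continuous (survival D lam g))
    (hfin : IsFiniteMeasure (((leb D).prod (volume : Measure ℝ)).withDensity
      fun p => ENNReal.ofReal (lam p.1 * Psi D lam p.1 p.2 g))) :
    (((leb D).prod (volume : Measure ℝ)).withDensity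
      fun p => ENNReal.ofReal (lam p.1 * Psi D lam p.1 p.2 g)).map Prod.fst =
      (leb D).withDensity fun x => ENNReal.ofReal (lam x * Phi D lam x g) := by
  have hm := measurable_mul_Psi hlamc hlam hg hs
  have htop := measure_ne_top (((leb D).prod (volume : Measure ℝ)).withDensity
      fun p => ENNReal.ofReal (lam p.1 * Psi D lam p.1 p.2 g)) univ
  rw [withDensity_apply _ MeasurableSet.univ, Measure.restrict_univ,
    lintegral_prod _ hm.aemeasurable] at htop
  have hae := ae_lt_top hm.lintegral_prod_right' htop
  ext S hS
  rw [Measure.map_apply measurable_fst hS, withDensity_apply _ hS,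
    withDensity_apply _ (measurable_fst hS), ← prod_univ, ← Measure.prod_restrict,
    Measure.restrict_univ, lintegral_prod _ hm.aemeasurable]
  refine lintegral_congr_ae (ae_restrict_of_ae ?_)
  filter_upwards [hae] with x hx
  exact lintegral_mul_Psi hlam hs x hx.ne

end Density

end ExtremeValue

/-! ### The theorem for the original process. -/

theorem mainTheorem7 {d : ℕ} (D : Set (EuclideanSpace ℝ (Fin d)))
    (hDo : IsOpen D) (hDb : Bornology.IsBounded D) (hDf : volume (frontier D) = 0)
    (lam : closure D → ℝ) (hlamc : Continuous lam) (hlam : ∀ x, 0 < lam x)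
    {Ω : Type*} [MeasurableSpace Ω] (P : Measure Ω) [IsProbabilityMeasure P]
    (W : Ω → ExtremeValue.LSCFun (closure D))
    (hW : ExtremeValue.IsExtremeValueProcess D lam P W)
    (g : ExtremeValue.LSCFun (closure D))
    (hg : ExtremeValue.leb D {x : closure D | g x ≠ ⊤} ≠ 0) :
    (∀ᵐ ω ∂P, ExtremeValue.minValue (fun x => W ω x + g x) ≠ ⊥ ∧
      ExtremeValue.minValue (fun x => W ω x + g x) ≠ ⊤ ∧
      ∃ x, ExtremeValue.argminSet (fun x => W ω x + g x) = {x}) ∧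
    ∀ (X : Ω → closure D) (τ : Ω → ℝ), AEMeasurable X P → AEMeasurable τ P →
      (∀ᵐ ω ∂P, X ω ∈ ExtremeValue.argminSet (fun x => W ω x + g x) ∧
        (τ ω : EReal) = ExtremeValue.minValue (fun x => W ω x + g x)) →
      P.map (fun ω => (X ω, τ ω)) =
        ((ExtremeValue.leb D).prod (volume : Measure ℝ)).withDensity
          (fun p => ENNReal.ofReal (lam p.1 * ExtremeValue.Psi D lam p.1 p.2 g)) ∧
      P.map X =
        (ExtremeValue.leb D).withDensity
          (fun x => ENNReal.ofReal (lam x * ExtremeValue.Phi D lam x g)) := by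
  have : CompactSpace (closure D) := isCompact_iff_compactSpace.1 hDb.isCompact_closure
  have := ExtremeValue.isFiniteMeasure_leb hDb
  have hlami := ExtremeValue.integrable_rate hlamc
  have := ExtremeValue.isFiniteMeasure_rateMeasure hlami
  have hpos : 0 < ExtremeValue.lamBar D lam :=
    ExtremeValue.lamBar_pos hDo hDf hlamc hlami hlam
      fun H => hg (measure_mono_null (subset_univ _) H)
  have hgt : ExtremeValue.rateMeasure D lam {x | g x ≠ ⊤} ≠ 0 := fun H =>
    hg (ExtremeValue.leb_absolutelyContinuous_rateMeasure hlamc hlam H)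
  have hV := hW.isExpInfProcess hlami hlam
  have hVlsc : ∀ ω, LowerSemicontinuous fun x => max (W ω x) 0 := fun ω =>
    (W ω).2.1.sup lowerSemicontinuous_const
  have hWV : ∀ᵐ ω ∂P, (fun x => max (W ω x) 0 + g x) = fun x => W ω x + g x := by
    filter_upwards [hW.ae_nonneg hlam] with ω hω
    funext x
    rw [max_eq_left (hω x)]
  have hsurv : ExtremeValue.survival D lam g =
      ExtremeValue.levelSurvival (ExtremeValue.rateMeasure D lam) g univ :=
    funext (ExtremeValue.survival_eq_levelSurvival hDo hDf hpos g)
  obtain ⟨b, hb⟩ := ExtremeValue.exists_coe_le g.2.1 g.2.2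
  have hs : Continuous (ExtremeValue.survival D lam g) :=
    hsurv ▸ ExtremeValue.levelSurvival_continuous hb
  constructor
  · filter_upwards [hWV, hV.ae_minValue_ne_top g.2.1 g.2.2 hgt,
      hV.ae_argminSet_eq_singleton g.2.1 g.2.2 hVlsc hgt] with ω hω h1 h2
    have h3 := hV.minValue_ne_bot g.2.1 g.2.2 ω
    rw [hω] at h1 h2 h3
    exact ⟨h3, h1, h2⟩
  · intro X τ hX hτ hXτ
    have hXτ' : ∀ᵐ ω ∂P, X ω ∈ ExtremeValue.argminSet (fun x => max (W ω x) 0 + g x) ∧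
        (τ ω : EReal) = ExtremeValue.minValue (fun x => max (W ω x) 0 + g x) := by
      filter_upwards [hWV, hXτ] with ω hω h1
      rwa [hω]
    have hjoint : P.map (fun ω => (X ω, τ ω)) =
        ((ExtremeValue.leb D).prod (volume : Measure ℝ)).withDensity
          (fun p => ENNReal.ofReal (lam p.1 * ExtremeValue.Psi D lam p.1 p.2 g)) := by
      -- The factor `λ` moves from the reference measure into the density.
      rw [hV.map_argmin_minValue g.2.1 g.2.2 hX hτ hXτ', ExtremeValue.rateMeasure,
        prod_withDensity_left hlamc.measurable.ennreal_ofReal, ← withDensity_mul _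
          (show Measurable fun z : closure D × ℝ => ENNReal.ofReal (lam z.1) from
            (hlamc.measurable.comp measurable_fst).ennreal_ofReal)]
      · congr 1
        funext p
        rw [ExtremeValue.ofReal_mul_Psi hlam, hsurv]
        rfl
      · change Measurable ({p : closure D × ℝ | g p.1 < p.2}.indicator fun p =>
          ENNReal.ofReal (ExtremeValue.levelSurvival (ExtremeValue.rateMeasure D lam) g univ p.2))
        rw [← hsurv]
        refine Measurable.indicator ?_ ?_
        · exact (hs.measurable.comp measurable_snd).ennreal_ofReal
        · exact measurableSet_lt (g.2.1.measurable.comp measurable_fst)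
            (measurable_coe_real_ereal.comp measurable_snd)
    refine ⟨hjoint, ?_⟩
    -- Finiteness of the density measure comes from `hjoint`, which identifies it with a pushforward
    -- of `P`.
    rw [← ExtremeValue.map_fst_withDensity_mul_Psi hlamc hlam g.2.1 hs (hjoint ▸ inferInstance),
      ← hjoint, AEMeasurable.map_map_of_aemeasurable measurable_fst.aemeasurable (hX.prodMk hτ)]
    rfl
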